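/- Work in Minkowski space of spacetime dimension at least three, and let $\mathcal K$ be the set of its double cones; $\mathcal O'$ denotes the causal complement of $\mathcal O$. A net $\mathfrak A$ assigns to each $\mathcal O\in\mathcal K$ a unital $C^*$-subalgebra $\mathfrak A(\mathcal O)$ of a unital $C^*$-algebra, also denoted $\mathfrak A$, such that $\mathcal O_1\subset\mathcal O_2$ implies $\mathfrak A(\mathcal O_1)\subset\mathfrak A(\mathcal O_2)$ and $\bigcup_{\mathcal O}\mathfrak A(\mathcal O)$ is norm dense in $\mathfrak A$. It satisfies relative duality if, for every $\mathcal O\in\mathcal K$, $\mathfrak A(\mathcal O)$ is the set of all $A\in\mathfrak A$ commuting with $\mathfrak A(\mathcal O_1)$ for every $\mathcal O_1\subset\mathcal O'$. An inclusion of nets $\mathfrak A\subset\mathfrak B$ is an injective unital $*$-homomorphism of the generated $C^*$-algebras mapping $\mathfrak A(\mathcal O)$ into $\mathfrak B(\mathcal O)$ for all $\mathcal O$. A unital $*$-endomorphism $\rho$ of $\mathfrak A$ is localized in $\mathcal O$ if $\rho(A)=A$ for $A\in\mathfrak A(\mathcal O_1)$, $\mathcal O_1\subset\mathcal O'$; it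 is transportable if for each $\mathcal O$ it is equivalent, by a unitary of $\mathfrak A$, to an endomorphism localized in $\mathcal O$. $\mathcal T_t(\mathfrak A)$ is the category of localized (in some double cone) transportable endomorphisms, with arrows $(\rho,\sigma)=\{T\in\mathfrak A: T\rho(A)=\sigma(A)T,\ A\in\mathfrak A\}$, with adjoint, linear structure and norm inherited from $\mathfrak A$, and with the strict tensor product $\rho\otimes\sigma=\rho\sigma$, $S\otimes T=S\rho(T)$ for $S\in(\rho,\rho')$, $T\in(\sigma,\sigma')$. Its canonical permutation symmetry is $\varepsilon(\rho,\sigma)=(U_2\otimes U_1)^*(U_1\otimes U_2)$ for any unitaries $U_1\in(\rho,\rho_1)$, $U_2\in(\sigma,\sigma_2)$ with $\rho_1,\sigma_2$ in $\mathcal T_t(\mathfrak A)$ localized in spacelike separated double cones. A $1$-simplex $b$ consists of a double cone $|b|$ (the support) and two double cones $\partial_0b,\partial_1b\subset|b|$ (the faces). A $2$-simplex $c$ consists of double cones $\mathcal O\supset\mathcal O_0\cup\mathcal O_1\cup\mathcal O_2$ and $\mathcal O_{01},\mathcal O_{02},\mathcal O_{12}$ such that $\partial_0c=(\mathcal O_0,\mathcal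 O_{01},\mathcal O_{02})$, $\partial_1c=(\mathcal O_1,\mathcal O_{01},\mathcal O_{12})$, $\partial_2c=(\mathcal O_2,\mathcal O_{02},\mathcal O_{12})$ are $1$-simplices (support, $\partial_0$, $\partial_1$). A $1$-cocycle of $\mathfrak A$ is a map $z$ from $1$-simplices to unitaries of $\mathfrak A$ with $z(b)\in\mathfrak A(|b|)$ and $z(\partial_0c)z(\partial_2c)=z(\partial_1c)$. The endomorphism $\rho_a$ which $z$ defines at $a\in\mathcal K$ is given by $\rho_a(A)=z(b)Az(b)^*$ for $A\in\mathfrak A(\mathcal O)$, $\partial_0b=a$, $\partial_1b\subset\mathcal O'$. **Theorem.** Let $\mathfrak A\subset\mathfrak B$ be an inclusion of nets satisfying relative duality. Then every $1$-cocycle of $\mathfrak A$ defines, at every $a\in\mathcal K$, an object of $\mathcal T_t(\mathfrak A)$ localized in $a$; every object of $\mathcal T_t(\mathfrak A)$ localized in $a$ arises in this way; the canonical permutation symmetries of $\mathcal T_t(\mathfrak A)$ and $\mathcal T_t(\mathfrak B)$ exist; and there is a functor $F:\mathcal T_t(\mathfrak A)\to\mathcal T_t(\mathfrak B)$ such that: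 1. $F(\rho)$ extends $\rho$, and whenever $\rho$ is defined at $a$ by a $1$-cocycle $z$ of $\mathfrak A$, $F(\rho)$ is the endomorphism of $\mathfrak B$ defined at $a$ by $z$ regarded as a $1$-cocycle of $\mathfrak B$; if $\rho$ is localized in $a$, so is $F(\rho)$. 2. $F(T)=T$ for every intertwiner $T$, i.e. $F$ is the given inclusion $\mathfrak A\subset\mathfrak B$ on arrows. 3. $F$ is injective on objects, faithful, $\mathbb C$-linear, isometric on spaces of arrows, and commutes with adjoints. 4. $F$ strictly preserves the tensor product and the tensor unit: $F(\rho\otimes\sigma)=F(\rho)\otimes F(\sigma)$, $F(\mathrm{id}_{\mathfrak A})=\mathrm{id}_{\mathfrak B}$, $F(S\otimes T)=F(S)\otimes F(T)$. 5. $F$ preserves the permutation symmetry: $F(\varepsilon_{\mathfrak A}(\rho,\sigma))=\varepsilon_{\mathfrak B}(F(\rho),F(\sigma))$. -/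

import Mathlib

open CategoryTheory MonoidalCategory

universe u v

noncomputable section

/-! ### Minkowski space and double cones -/

/-- Minkowski space with one time and `s` space dimensions; a point is a pair (time, position). -/
abbrev Minkowski (s : ℕ) : Type := ℝ × EuclideanSpace ℝ (Fin s)

namespace Minkowski

variable {s : ℕ}

/-- `x` lies in the open forward light cone. -/
def InForwardCone (x : Minkowski s) : Prop := ‖x.2‖ < x.1

/-- `x` and `y` are spacelike separated. -/
def Spacelike (x y : Minkowski s) : Prop := |x.1 - y.1| < ‖x.2 - y.2‖

/-- The causal (spacelike) complement `S'` of a region `S`. -/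
def causalComplement (S : Set (Minkowski s)) : Set (Minkowski s) :=
  {x | ∀ y ∈ S, Spacelike x y}

theorem InForwardCone.add {x y : Minkowski s} (hx : InForwardCone x) (hy : InForwardCone y) :
    InForwardCone (x + y) := by
  unfold InForwardCone at *
  have := norm_add_le x.2 y.2
  simp only [Prod.snd_add, Prod.fst_add]
  linarith

end Minkowski

open Minkowski

/-- A double cone, given by its past and future vertices. -/
structure DoubleCone (s : ℕ) where
  past : Minkowski s
  future : Minkowski s
  timelike : InForwardCone (future - past)

namespace DoubleCone

variable {s : ℕ}

/-- The region of the double cone: the intersection of the open forward light cone at the past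
vertex with the open backward light cone at the future vertex. -/
def region (O : DoubleCone s) : Set (Minkowski s) :=
  {x | InForwardCone (x - O.past) ∧ InForwardCone (O.future - x)}

/-- `O₁ ⊆ O₂`. -/
def Sub (O₁ O₂ : DoubleCone s) : Prop := O₁.region ⊆ O₂.region

/-- `O₁ ⊆ O₂'`, where `O₂'` is the causal complement of `O₂`. -/
def SpacelikeTo (O₁ O₂ : DoubleCone s) : Prop := O₁.region ⊆ causalComplement O₂.region

theorem Sub.refl (O : DoubleCone s) : O.Sub O := Set.Subset.refl _

theorem Sub.trans {O₁ O₂ O₃ : DoubleCone s} (h : O₁.Sub O₂) (h' : O₂.Sub O₃) : O₁.Sub O₃ :=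
  Set.Subset.trans h h'

theorem SpacelikeTo.mono {O O₁ O₂ : DoubleCone s} (h : O.SpacelikeTo O₂) (h' : O₁.Sub O₂) :
    O.SpacelikeTo O₁ := fun _ hx y hy => h hx y (h' hy)

/-- Double cones are directed under inclusion. -/
theorem exists_sup (O₁ O₂ : DoubleCone s) : ∃ O : DoubleCone s, O₁.Sub O ∧ O₂.Sub O := by
  set T : ℝ := |O₁.past.1| + ‖O₁.past.2‖ + |O₁.future.1| + ‖O₁.future.2‖
    + |O₂.past.1| + ‖O₂.past.2‖ + |O₂.future.1| + ‖O₂.future.2‖ + 1 with hT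
  have a1 := neg_abs_le O₁.past.1
  have a2 := le_abs_self O₁.future.1
  have a3 := neg_abs_le O₂.past.1
  have a4 := le_abs_self O₂.future.1
  have b1 := norm_nonneg O₁.past.2
  have b2 := norm_nonneg O₁.future.2
  have b3 := norm_nonneg O₂.past.2
  have b4 := norm_nonneg O₂.future.2
  have c1 := abs_nonneg O₁.past.1
  have c2 := abs_nonneg O₁.future.1
  have c3 := abs_nonneg O₂.past.1
  have c4 := abs_nonneg O₂.future.1
  have d1 : InForwardCone (O₁.past - ((-T, 0) : Minkowski s)) := by
    simp only [InForwardCone, Prod.fst_sub, Prod.snd_sub, sub_zero]; linarith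
  have d2 : InForwardCone (((T, 0) : Minkowski s) - O₁.future) := by
    simp only [InForwardCone, Prod.fst_sub, Prod.snd_sub, zero_sub, norm_neg]; linarith
  have d3 : InForwardCone (O₂.past - ((-T, 0) : Minkowski s)) := by
    simp only [InForwardCone, Prod.fst_sub, Prod.snd_sub, sub_zero]; linarith
  have d4 : InForwardCone (((T, 0) : Minkowski s) - O₂.future) := by
    simp only [InForwardCone, Prod.fst_sub, Prod.snd_sub, zero_sub, norm_neg]; linarith
  refine ⟨⟨(-T, 0), (T, 0), ?_⟩, fun x hx => ⟨?_, ?_⟩, fun x hx => ⟨?_, ?_⟩⟩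
  · simp only [InForwardCone, Prod.fst_sub, Prod.snd_sub, sub_zero, norm_zero]; linarith
  · simpa using hx.1.add d1
  · simpa using d2.add hx.2
  · simpa using hx.1.add d3
  · simpa using d4.add hx.2

end DoubleCone

/-! ### Simplices of the partially ordered set of double cones -/

/-- A `1`-simplex `b`: a support `|b|` and two faces `∂₀b`, `∂₁b` contained in it. -/
structure OneSimplex (s : ℕ) where
  support : DoubleCone s
  face0 : DoubleCone s
  face1 : DoubleCone s
  sub0 : face0.Sub support
  sub1 : face1.Sub support

/-- A `2`-simplex `c = (O, O₀, O₁, O₂, O₀₁, O₀₂, O₁₂)`. -/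
structure TwoSimplex (s : ℕ) where
  support : DoubleCone s
  o0 : DoubleCone s
  o1 : DoubleCone s
  o2 : DoubleCone s
  o01 : DoubleCone s
  o02 : DoubleCone s
  o12 : DoubleCone s
  sub0 : o0.Sub support
  sub1 : o1.Sub support
  sub2 : o2.Sub support
  sub01_0 : o01.Sub o0
  sub02_0 : o02.Sub o0
  sub01_1 : o01.Sub o1
  sub12_1 : o12.Sub o1
  sub02_2 : o02.Sub o2
  sub12_2 : o12.Sub o2

namespace TwoSimplex

variable {s : ℕ}

/-- `∂₀c = (O₀, O₀₁, O₀₂)`. -/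
def face0 (c : TwoSimplex s) : OneSimplex s := ⟨c.o0, c.o01, c.o02, c.sub01_0, c.sub02_0⟩

/-- `∂₁c = (O₁, O₀₁, O₁₂)`. -/
def face1 (c : TwoSimplex s) : OneSimplex s := ⟨c.o1, c.o01, c.o12, c.sub01_1, c.sub12_1⟩

/-- `∂₂c = (O₂, O₀₂, O₁₂)`. -/
def face2 (c : TwoSimplex s) : OneSimplex s := ⟨c.o2, c.o02, c.o12, c.sub02_2, c.sub12_2⟩

end TwoSimplex

/-! ### Nets of C*-algebras -/

/-- A net of unital C*-algebras over the double cones, generating the C*-algebra `𝔄`. -/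
structure Net (s : ℕ) (𝔄 : Type u) [CStarAlgebra 𝔄] where
  alg : DoubleCone s → StarSubalgebra ℂ 𝔄
  isClosed : ∀ O, IsClosed (alg O : Set 𝔄)
  mono : ∀ {O₁ O₂}, O₁.Sub O₂ → alg O₁ ≤ alg O₂
  dense : Dense (⋃ O, (alg O : Set 𝔄))

namespace Net

variable {s : ℕ} {𝔄 : Type u} [CStarAlgebra 𝔄] {𝔅 : Type v} [CStarAlgebra 𝔅]

/-- Relative duality: `𝔄(O) = 𝔄(O')' ∩ 𝔄`, where `𝔄(O')` is generated by the `𝔄(O₁)` with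
`O₁ ⊆ O'`. -/
def RelativeDuality (N : Net s 𝔄) : Prop :=
  ∀ O, (N.alg O : Set 𝔄) =
    {A | ∀ O₁ : DoubleCone s, O₁.SpacelikeTo O → ∀ B ∈ N.alg O₁, A * B = B * A}

/-- An inclusion of nets: an injective unital *-homomorphism of the generated C*-algebras that
maps `𝔄(O)` into `𝔅(O)`. -/
structure Inclusion (A : Net s 𝔄) (B : Net s 𝔅) where
  hom : 𝔄 →⋆ₐ[ℂ] 𝔅
  injective : Function.Injective hom
  map_mem : ∀ O, ∀ x ∈ A.alg O, hom x ∈ B.alg O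

/-- The endomorphism `ρ` is localized in `O`: it is the identity on `𝔄(O₁)` for `O₁ ⊆ O'`. -/
def LocalizedIn (N : Net s 𝔄) (ρ : 𝔄 →⋆ₐ[ℂ] 𝔄) (O : DoubleCone s) : Prop :=
  ∀ O₁ : DoubleCone s, O₁.SpacelikeTo O → ∀ A ∈ N.alg O₁, ρ A = A

/-- The endomorphism `ρ` is transportable: for every double cone `O` it is inner equivalent to
an endomorphism localized in `O`. -/
def Transportable (N : Net s 𝔄) (ρ : 𝔄 →⋆ₐ[ℂ] 𝔄) : Prop :=
  ∀ O : DoubleCone s, ∃ σ : 𝔄 →⋆ₐ[ℂ] 𝔄, N.LocalizedIn σ O ∧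
    ∃ U ∈ unitary 𝔄, ∀ A, U * ρ A = σ A * U

theorem LocalizedIn.mono {N : Net s 𝔄} {ρ : 𝔄 →⋆ₐ[ℂ] 𝔄} {O₁ O₂ : DoubleCone s}
    (h : N.LocalizedIn ρ O₁) (hO : O₁.Sub O₂) : N.LocalizedIn ρ O₂ :=
  fun O hO' A hA => h O (hO'.mono hO) A hA

theorem LocalizedIn.comp {N : Net s 𝔄} {ρ σ : 𝔄 →⋆ₐ[ℂ] 𝔄} {O : DoubleCone s}
    (hρ : N.LocalizedIn ρ O) (hσ : N.LocalizedIn σ O) : N.LocalizedIn (ρ.comp σ) O := by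
  intro O₁ hO A hA
  rw [StarAlgHom.comp_apply, hσ O₁ hO A hA, hρ O₁ hO A hA]

theorem Transportable.comp {N : Net s 𝔄} {ρ σ : 𝔄 →⋆ₐ[ℂ] 𝔄}
    (hρ : N.Transportable ρ) (hσ : N.Transportable σ) : N.Transportable (ρ.comp σ) := by
  intro O
  obtain ⟨ρ', hρ', U, hU, hUρ⟩ := hρ O
  obtain ⟨σ', hσ', V, hV, hVσ⟩ := hσ O
  refine ⟨ρ'.comp σ', hρ'.comp hσ', U * ρ V, mul_mem hU (Unitary.map_mem ρ hV), fun A => ?_⟩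
  rw [StarAlgHom.comp_apply, StarAlgHom.comp_apply, mul_assoc, ← map_mul, hVσ, map_mul,
    ← mul_assoc, hUρ, mul_assoc]

/-! ### The category of localized transportable endomorphisms -/

/-- An object of `𝒯_t(𝔄)`: a localized and transportable endomorphism of `𝔄`. -/
@[ext]
structure Tt (N : Net s 𝔄) where
  endo : 𝔄 →⋆ₐ[ℂ] 𝔄
  localized : ∃ O, N.LocalizedIn endo O
  transportable : N.Transportable endo

namespace Tt

variable {N : Net s 𝔄}

/-- An arrow from `ρ` to `σ` in `𝒯_t(𝔄)`: an intertwiner `T ∈ 𝔄`, `T ρ(A) = σ(A) T`. -/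
@[ext]
structure Hom (ρ σ : Tt N) where
  val : 𝔄
  intertwines : ∀ A, val * ρ.endo A = σ.endo A * val

instance : Category (Tt N) where
  Hom ρ σ := Hom ρ σ
  id ρ := ⟨1, fun A => by rw [one_mul, mul_one]⟩
  comp f g := ⟨g.val * f.val, fun A => by
    rw [mul_assoc, f.intertwines, ← mul_assoc, g.intertwines, mul_assoc]⟩
  id_comp f := Hom.ext (mul_one f.val)
  comp_id f := Hom.ext (one_mul f.val)
  assoc f g h := Hom.ext (mul_assoc h.val g.val f.val).symm

/-- The element of `𝔄` underlying an arrow. -/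
def elem {ρ σ : Tt N} (f : ρ ⟶ σ) : 𝔄 := Hom.val f

/-- The arrow given by an intertwiner. -/
def ofElem {ρ σ : Tt N} (T : 𝔄) (h : ∀ A, T * ρ.endo A = σ.endo A * T) : ρ ⟶ σ := ⟨T, h⟩

theorem elem_intertwines {ρ σ : Tt N} (f : ρ ⟶ σ) (A : 𝔄) :
    elem f * ρ.endo A = σ.endo A * elem f := Hom.intertwines f A

theorem elem_injective {ρ σ : Tt N} : Function.Injective (elem : (ρ ⟶ σ) → 𝔄) :=
  fun _ _ h => Hom.ext h

theorem hom_ext {ρ σ : Tt N} {f g : ρ ⟶ σ} (h : elem f = elem g) : f = g := elem_injective h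

@[simp] theorem elem_ofElem {ρ σ : Tt N} (T : 𝔄) (h : ∀ A, T * ρ.endo A = σ.endo A * T) :
    elem (ofElem T h : ρ ⟶ σ) = T := rfl

@[simp] theorem elem_id (ρ : Tt N) : elem (𝟙 ρ) = 1 := rfl

@[simp] theorem elem_comp {ρ σ τ : Tt N} (f : ρ ⟶ σ) (g : σ ⟶ τ) :
    elem (f ≫ g) = elem g * elem f := rfl

/-! The linear structure, the adjoint and the norm on the spaces of intertwiners are those
inherited from `𝔄`. -/

instance (ρ σ : Tt N) : Zero (ρ ⟶ σ) := ⟨ofElem 0 fun A => by simp⟩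

instance (ρ σ : Tt N) : Add (ρ ⟶ σ) :=
  ⟨fun f g => ofElem (elem f + elem g) fun A => by
    rw [add_mul, mul_add, elem_intertwines, elem_intertwines]⟩

instance (ρ σ : Tt N) : Neg (ρ ⟶ σ) :=
  ⟨fun f => ofElem (-elem f) fun A => by rw [neg_mul, mul_neg, elem_intertwines]⟩

instance (ρ σ : Tt N) : Sub (ρ ⟶ σ) :=
  ⟨fun f g => ofElem (elem f - elem g) fun A => by
    rw [sub_mul, mul_sub, elem_intertwines, elem_intertwines]⟩

instance (ρ σ : Tt N) : SMul ℕ (ρ ⟶ σ) :=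
  ⟨fun n f => ofElem (n • elem f) fun A => by
    rw [smul_mul_assoc, mul_smul_comm, elem_intertwines]⟩

instance (ρ σ : Tt N) : SMul ℤ (ρ ⟶ σ) :=
  ⟨fun n f => ofElem (n • elem f) fun A => by
    rw [smul_mul_assoc, mul_smul_comm, elem_intertwines]⟩

instance (ρ σ : Tt N) : SMul ℂ (ρ ⟶ σ) :=
  ⟨fun n f => ofElem (n • elem f) fun A => by
    rw [smul_mul_assoc, mul_smul_comm, elem_intertwines]⟩

instance (ρ σ : Tt N) : AddCommGroup (ρ ⟶ σ) :=
  Function.Injective.addCommGroup elem elem_injective rfl (fun _ _ => rfl) (fun _ => rfl)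
    (fun _ _ => rfl) (fun _ _ => rfl) (fun _ _ => rfl)

@[simp] theorem elem_add {ρ σ : Tt N} (f g : ρ ⟶ σ) : elem (f + g) = elem f + elem g := rfl

@[simp] theorem elem_smul {ρ σ : Tt N} (c : ℂ) (f : ρ ⟶ σ) : elem (c • f) = c • elem f := rfl

instance : Preadditive (Tt N) where
  add_comp _ _ _ f f' g := hom_ext (by simp only [elem_comp, elem_add, mul_add])
  comp_add _ _ _ f g g' := hom_ext (by simp only [elem_comp, elem_add, add_mul])

instance (ρ σ : Tt N) : Module ℂ (ρ ⟶ σ) :=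
  Function.Injective.module ℂ (⟨⟨elem, rfl⟩, fun _ _ => rfl⟩ : (ρ ⟶ σ) →+ 𝔄) elem_injective
    (fun _ _ => rfl)

instance : Linear ℂ (Tt N) where
  homModule _ _ := inferInstance
  smul_comp _ _ _ r f g := hom_ext (mul_smul_comm r (elem g) (elem f))
  comp_smul _ _ _ f r g := hom_ext (smul_mul_assoc r (elem g) (elem f))

/-- The adjoint `T* ∈ (σ, ρ)` of an intertwiner `T ∈ (ρ, σ)`. -/
def adjoint {ρ σ : Tt N} (f : ρ ⟶ σ) : σ ⟶ ρ :=
  ofElem (star (elem f)) fun A => by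
    have h := congrArg star (elem_intertwines f (star A))
    simpa [map_star] using h.symm

instance (ρ σ : Tt N) : Norm (ρ ⟶ σ) := ⟨fun f => ‖elem f‖⟩

/-- The tensor product: composition of endomorphisms on objects, and
`S ⊗ T = S ρ(T)` for `S ∈ (ρ, ρ')` and `T ∈ (σ, σ')` on arrows. -/
instance : MonoidalCategoryStruct (Tt N) where
  tensorObj ρ σ :=
    { endo := ρ.endo.comp σ.endo
      localized := by
        obtain ⟨O₁, h₁⟩ := ρ.localized
        obtain ⟨O₂, h₂⟩ := σ.localized
        obtain ⟨O, hO₁, hO₂⟩ := DoubleCone.exists_sup O₁ O₂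
        exact ⟨O, (h₁.mono hO₁).comp (h₂.mono hO₂)⟩
      transportable := ρ.transportable.comp σ.transportable }
  whiskerLeft ρ _ _ g := ofElem (ρ.endo (elem g)) fun A => by
    simp only [StarAlgHom.comp_apply]
    rw [← map_mul, elem_intertwines, map_mul]
  whiskerRight f σ := ofElem (elem f) fun A => elem_intertwines f (σ.endo A)
  tensorHom {ρ ρ' σ σ'} f g := ofElem (elem f * ρ.endo (elem g)) fun A => by
    simp only [StarAlgHom.comp_apply]
    rw [mul_assoc, ← map_mul, elem_intertwines, elem_intertwines, elem_intertwines, map_mul,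
      mul_assoc]
  tensorUnit :=
    { endo := StarAlgHom.id ℂ 𝔄
      localized := ⟨⟨0, (1, 0), by simp [InForwardCone]⟩, fun _ _ _ _ => rfl⟩
      transportable := fun _ => ⟨StarAlgHom.id ℂ 𝔄, fun _ _ _ _ => rfl, 1, one_mem _,
        fun A => by simp⟩ }
  associator ρ σ τ :=
    { hom := ofElem 1 fun A => by rw [one_mul, mul_one]; rfl
      inv := ofElem 1 fun A => by rw [one_mul, mul_one]; rfl
      hom_inv_id := hom_ext (mul_one (1 : 𝔄))
      inv_hom_id := hom_ext (mul_one (1 : 𝔄)) }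
  leftUnitor ρ :=
    { hom := ofElem 1 fun A => by rw [one_mul, mul_one]; rfl
      inv := ofElem 1 fun A => by rw [one_mul, mul_one]; rfl
      hom_inv_id := hom_ext (mul_one (1 : 𝔄))
      inv_hom_id := hom_ext (mul_one (1 : 𝔄)) }
  rightUnitor ρ :=
    { hom := ofElem 1 fun A => by rw [one_mul, mul_one]; rfl
      inv := ofElem 1 fun A => by rw [one_mul, mul_one]; rfl
      hom_inv_id := hom_ext (mul_one (1 : 𝔄))
      inv_hom_id := hom_ext (mul_one (1 : 𝔄)) }

@[simp] theorem endo_tensor (ρ σ : Tt N) : (ρ ⊗ σ).endo = ρ.endo.comp σ.endo := rfl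

@[simp] theorem endo_unit : (𝟙_ (Tt N)).endo = StarAlgHom.id ℂ 𝔄 := rfl

@[simp] theorem elem_tensorHom {ρ ρ' σ σ' : Tt N} (f : ρ ⟶ ρ') (g : σ ⟶ σ') :
    elem (f ⊗ₘ g) = elem f * ρ.endo (elem g) := rfl

@[simp] theorem elem_whiskerLeft (ρ : Tt N) {σ σ' : Tt N} (g : σ ⟶ σ') :
    elem (ρ ◁ g) = ρ.endo (elem g) := rfl

@[simp] theorem elem_whiskerRight {ρ ρ' : Tt N} (f : ρ ⟶ ρ') (σ : Tt N) :
    elem (f ▷ σ) = elem f := rfl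

@[simp] theorem elem_associator_hom (ρ σ τ : Tt N) : elem (α_ ρ σ τ).hom = 1 := rfl

@[simp] theorem elem_leftUnitor_hom (ρ : Tt N) : elem (λ_ ρ).hom = 1 := rfl

@[simp] theorem elem_rightUnitor_hom (ρ : Tt N) : elem (ρ_ ρ).hom = 1 := rfl

instance : MonoidalCategory (Tt N) :=
  MonoidalCategory.ofTensorHom
    (id_tensorHom_id := fun ρ σ => hom_ext (by simp))
    (id_tensorHom := fun ρ _ _ f => hom_ext (by simp))
    (tensorHom_id := fun f σ => hom_ext (by simp))
    (tensorHom_comp_tensorHom := fun {ρ₁ σ₁ _ _ _ _} f₁ f₂ g₁ g₂ => hom_ext (by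
      simp only [elem_comp, elem_tensorHom, map_mul]
      rw [mul_assoc, ← mul_assoc (σ₁.endo _), ← elem_intertwines]
      simp only [mul_assoc]))
    (associator_naturality := fun f₁ f₂ f₃ => hom_ext (by simp [mul_assoc]))
    (leftUnitor_naturality := fun f => hom_ext (by simp))
    (rightUnitor_naturality := fun f => hom_ext (by simp))
    (pentagon := fun _ _ _ _ => hom_ext (by simp))
    (triangle := fun _ _ => hom_ext (by simp))

/-- `ε` is the canonical permutation symmetry of `𝒯_t(𝔄)`: if `U₁ ∈ (ρ, ρ₁)` and
`U₂ ∈ (σ, σ₂)` are unitaries, where `ρ₁` and `σ₂` are localized in spacelike separated double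
cones, then `ε(ρ, σ) = (U₂ ⊗ U₁)* (U₁ ⊗ U₂)`. -/
def IsCanonicalSymmetry (N : Net s 𝔄) (ε : SymmetricCategory (Tt N)) : Prop :=
  ∀ (ρ σ ρ₁ σ₂ : Tt N) (O₁ O₂ : DoubleCone s), O₁.SpacelikeTo O₂ →
    N.LocalizedIn ρ₁.endo O₁ → N.LocalizedIn σ₂.endo O₂ →
    ∀ (U₁ : ρ ⟶ ρ₁) (U₂ : σ ⟶ σ₂), elem U₁ ∈ unitary 𝔄 → elem U₂ ∈ unitary 𝔄 →
      elem (ε.braiding ρ σ).hom = star (elem (U₂ ⊗ₘ U₁)) * elem (U₁ ⊗ₘ U₂)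

end Tt

/-! ### One-cocycles and the endomorphisms they define -/

/-- A `1`-cocycle of the net: `z(∂₀c) z(∂₂c) = z(∂₁c)`, with `z(b)` a unitary of `𝔄(|b|)`. -/
structure OneCocycle (N : Net s 𝔄) where
  toFun : OneSimplex s → 𝔄
  unitary_mem : ∀ b, toFun b ∈ unitary 𝔄
  local_mem : ∀ b, toFun b ∈ N.alg b.support
  cocycle : ∀ c : TwoSimplex s, toFun c.face0 * toFun c.face2 = toFun c.face1

/-- `ρ` is the endomorphism `ρ_a` which the cocycle `z` defines at the double cone `a`:
`ρ(A) = z(b) A z(b)*` whenever `A ∈ 𝔄(O)`, `∂₀b = a` and `∂₁b ⊆ O'`. -/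
def OneCocycle.Induces {N : Net s 𝔄} (z : N.OneCocycle) (a : DoubleCone s) (ρ : 𝔄 →⋆ₐ[ℂ] 𝔄) :
    Prop :=
  ∀ O : DoubleCone s, ∀ A ∈ N.alg O, ∀ b : OneSimplex s, b.face0 = a → b.face1.SpacelikeTo O →
    ρ A = z.toFun b * A * star (z.toFun b)

/-- The image of a `1`-cocycle of `𝔄` under an inclusion of nets `𝔄 ⊆ 𝔅`. -/
def OneCocycle.map {A : Net s 𝔄} {B : Net s 𝔅} (i : A.Inclusion B) (z : A.OneCocycle) :
    B.OneCocycle where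
  toFun b := i.hom (z.toFun b)
  unitary_mem b := Unitary.map_mem i.hom (z.unitary_mem b)
  local_mem b := i.map_mem _ _ (z.local_mem b)
  cocycle c := by rw [← map_mul, z.cocycle]

end Net

end

/-! A cocycle is path independent: since double cones are directed, z(b) depends only on the two
faces and behaves like a product U_a U_b*. For A in 𝔄(O) the operator z(a,b) A z(b,a) does not
depend on the choice of b in O'. Indeed, two such b are joined by a chain of double cones inside O',
and the cocycle along it is a product of elements of local algebras commuting with A. The chain
exists because O' is connected, and it is here that spacetime dimension at least three matters.
Sending b to spatial infinity yields the endomorphism `ρ_a` as a pointwise limit of inner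
automorphisms (`OneCocycle.exists_induces`). Conversely, the unitaries transporting a localized
endomorphism give a cocycle, which is local because intertwiners between endomorphisms localized in
O lie in 𝔄(O) by duality.

A cocycle of 𝔄 is also one of 𝔅, so the same construction extends ρ to 𝔅. The extension ψ is
characterized without a cocycle by `IsExtension`: i(U) ψ(X) = X i(U) for X in 𝔅(O) and every unitary
U transporting ρ to a double cone in O'. Uniqueness, functoriality and multiplicativity all follow
from this relation together with duality in 𝔄 and locality in 𝔅.

The symmetry has the form U* ρ(U), with U moving σ spacelike to ρ. Independence of U rests on
`LocalizedIn.map_intertwiner`: an endomorphism localized in c fixes intertwiners between objects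
localized in c', even when their localizations are far apart. As the extension agrees with ρ on i(𝔄)
and keeps localizations, it preserves this formula. -/

noncomputable section

open Minkowski

/-! ### Light cones and the exterior of an ellipsoid. -/

namespace Minkowski

variable {s : ℕ}

theorem Spacelike.symm {x y : Minkowski s} (h : Spacelike x y) : Spacelike y x := by
  unfold Spacelike at *
  rwa [abs_sub_comm, norm_sub_rev]

theorem isOpen_inForwardCone : IsOpen {x : Minkowski s | InForwardCone x} := by
  unfold InForwardCone
  exact isOpen_lt (by fun_prop) (by fun_prop)

theorem InForwardCone.smul {x : Minkowski s} (hx : InForwardCone x) {t : ℝ} (ht : 0 < t) :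
    InForwardCone (t • x) := by
  unfold InForwardCone at *
  simp only [Prod.smul_snd, Prod.smul_fst, norm_smul, Real.norm_eq_abs, abs_of_pos ht, smul_eq_mul]
  exact mul_lt_mul_of_pos_left hx ht

theorem InForwardCone.not_spacelike {x y : Minkowski s} (h : InForwardCone (x - y)) :
    ¬ Spacelike x y := by
  intro h'
  unfold InForwardCone Spacelike at *
  have := le_abs_self (x.1 - y.1)
  simp only [Prod.fst_sub, Prod.snd_sub] at h
  linarith

end Minkowski

/-- The exterior of a filled ellipsoid (given by its foci) is connected in dimension at least
two. -/
theorem isPreconnected_ellipsoid_exterior {E : Type*} [NormedAddCommGroup E] [NormedSpace ℝ E]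
    (hE : 1 < Module.rank ℝ E) (P Q : E) (τ : ℝ) :
    IsPreconnected {v : E | τ < ‖v - P‖ + ‖v - Q‖} := by
  set M : E := (2⁻¹ : ℝ) • (P + Q) with hM
  set g : E → ℝ := fun v => ‖v - P‖ + ‖v - Q‖ with hg
  have hconv (x y : E) (a b : ℝ) (ha : 0 ≤ a) (hb : 0 ≤ b) (hab : a + b = 1) :
      g (a • x + b • y) ≤ a * g x + b * g y := by
    have h (R : E) : ‖a • x + b • y - R‖ ≤ a * ‖x - R‖ + b * ‖y - R‖ := by
      have e : a • x + b • y - R = a • (x - R) + b • (y - R) := by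
        obtain rfl : b = 1 - a := by linarith
        module
      rw [e]
      refine (norm_add_le _ _).trans_eq ?_
      rw [norm_smul, norm_smul, Real.norm_of_nonneg ha, Real.norm_of_nonneg hb]
    have h1 := h P
    have h2 := h Q
    simp only [hg]
    linarith
  have hsymm (w : E) : g (M - w) = g (M + w) := by
    have h1 : M - w - P = -(M + w - Q) := by rw [hM]; module
    have h2 : M - w - Q = -(M + w - P) := by rw [hM]; module
    simp only [hg, h1, h2, norm_neg, add_comm]
  have hlower (w : E) : 2 * ‖w‖ ≤ g (M + w) := by
    have h1 : (2 : ℝ) • w = (M + w - P) + (M + w - Q) := by rw [hM]; module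
    have h2 := norm_add_le (M + w - P) (M + w - Q)
    rwa [← h1, norm_smul, Real.norm_ofNat] at h2
  have hmono (w : E) (t : ℝ) (ht : 1 ≤ t) : g (M + w) ≤ g (M + t • w) := by
    have ht0 : 0 < t := by linarith
    -- `M + w` lies between the antipodal points `M ± t • w`, where `g` takes equal values;
    -- convexity then bounds `g` at `M + w`.
    have key := hconv (M + t • w) (M - t • w) ((1 + t⁻¹) / 2) ((1 - t⁻¹) / 2) (by positivity)
      (by have := inv_le_one_of_one_le₀ ht; linarith) (by ring)
    have e : ((1 + t⁻¹) / 2) • (M + t • w) + ((1 - t⁻¹) / 2) • (M - t • w) = M + w := by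
      have : w = (t⁻¹ * t) • w := by rw [inv_mul_cancel₀ ht0.ne', one_smul]
      nth_rw 3 [this]
      module
    rw [e, hsymm] at key
    linarith
  refine isPreconnected_of_forall_pair fun x hx y hy => ?_
  set a := x - M
  set b := y - M
  have hxa : x = M + a := by simp [a]
  have hyb : y = M + b := by simp [b]
  obtain ⟨w₀, hw₀⟩ : ∃ w : E, w ≠ 0 := by
    by_contra! h
    have : Subsingleton E := ⟨fun x y => by rw [h x, h y]⟩
    simp at hE
  -- Large enough for the ball of radius `R` about `M` to contain both points, and for its sphere to
  -- lie in the exterior by `hlower`.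
  set R : ℝ := max (max ‖a‖ ‖b‖) (|τ| + 1) with hR
  have hRpos : 0 < R := lt_of_lt_of_le (by positivity) (le_max_right _ _)
  have hsphere : ∀ v ∈ Metric.sphere M R, τ < g v := by
    intro v hv
    have h1 := hlower (v - M)
    rw [add_sub_cancel, mem_sphere_iff_norm.1 hv] at h1
    have h2 : |τ| + 1 ≤ R := le_max_right _ _
    have h3 := le_abs_self τ
    have h4 := abs_nonneg τ
    linarith
  -- Moving outward from the centre of symmetry never decreases `g`, so each exterior point reaches
  -- the sphere without leaving the exterior.
  have ray : ∀ w : E, ‖w‖ ≤ R → τ < g (M + w) →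
      ∃ t : Set E, IsPreconnected t ∧ t ⊆ {v | τ < g v} ∧ M + w ∈ t ∧
        (t ∩ Metric.sphere M R).Nonempty := by
    intro w hw hgw
    by_cases h0 : w = 0
    · subst h0
      have h1 : (R * ‖w₀‖⁻¹) • w₀ ∈ {w : E | ‖w‖ = R} := by
        simp [norm_smul, abs_of_pos hRpos, hw₀]
      refine ⟨(fun t : ℝ => M + t • w₀) '' Set.univ, isPreconnected_univ.image _
        (by fun_prop), ?_, ⟨0, trivial, by simp⟩, ⟨M + (R * ‖w₀‖⁻¹) • w₀, ⟨_, trivial, rfl⟩, by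
          simpa using h1⟩⟩
      rintro _ ⟨t, -, rfl⟩
      refine lt_of_lt_of_le hgw ?_
      have key := hconv (M + t • w₀) (M - t • w₀) (1 / 2) (1 / 2) (by positivity)
        (by positivity) (by ring)
      have e : (1 / 2 : ℝ) • (M + t • w₀) + (1 / 2 : ℝ) • (M - t • w₀) = M + 0 := by module
      rw [e, hsymm] at key
      linarith
    · have hw0 : 0 < ‖w‖ := norm_pos_iff.2 h0
      refine ⟨(fun t : ℝ => M + t • w) '' Set.Ici 1, isPreconnected_Ici.image _
        (by fun_prop), ?_, ⟨1, by simp, by simp⟩,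
        ⟨M + (R * ‖w‖⁻¹) • w, ⟨R * ‖w‖⁻¹, ?_, rfl⟩, ?_⟩⟩
      · rintro _ ⟨t, ht, rfl⟩
        exact lt_of_lt_of_le hgw (hmono w t ht)
      · rw [Set.mem_Ici, ← div_eq_mul_inv, one_le_div hw0]
        exact hw
      · simp [norm_smul, abs_of_pos hRpos, h0]
  obtain ⟨t₁, c₁, s₁, m₁, z₁, hz₁, hz₁'⟩ :=
    ray a ((le_max_left _ _).trans (le_max_left _ _)) (hxa ▸ hx)
  obtain ⟨t₂, c₂, s₂, m₂, z₂, hz₂, hz₂'⟩ :=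
    ray b ((le_max_right _ _).trans (le_max_left _ _)) (hyb ▸ hy)
  have hS := isPreconnected_sphere hE M R
  refine ⟨t₁ ∪ Metric.sphere M R ∪ t₂, ?_, Or.inl (Or.inl (hxa ▸ m₁)), Or.inr (hyb ▸ m₂), ?_⟩
  · exact Set.union_subset (Set.union_subset s₁ hsphere) s₂
  · exact (c₁.union z₁ hz₁ hz₁' hS).union z₂ (Or.inr hz₂') hz₂ c₂

/-! ### Causal complements of double cones and their connectedness. -/

namespace DoubleCone

variable {s : ℕ}

theorem isOpen_region (O : DoubleCone s) : IsOpen O.region :=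
  (isOpen_inForwardCone.preimage (by fun_prop : Continuous fun x : Minkowski s => x - O.past)).inter
    (isOpen_inForwardCone.preimage
      (by fun_prop : Continuous fun x : Minkowski s => O.future - x))

theorem region_nonempty (O : DoubleCone s) : O.region.Nonempty := by
  have h := O.timelike.smul (t := 1 / 2) (by norm_num)
  refine ⟨O.past + (1 / 2 : ℝ) • (O.future - O.past), ?_, ?_⟩
  · simpa using h
  · have e : O.future - (O.past + (1 / 2 : ℝ) • (O.future - O.past))
        = (1 / 2 : ℝ) • (O.future - O.past) := by module
    rwa [e]

theorem SpacelikeTo.symm {O₁ O₂ : DoubleCone s} (h : O₁.SpacelikeTo O₂) : O₂.SpacelikeTo O₁ :=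
  fun _ hx _ hy => (h hy _ hx).symm

theorem SpacelikeTo.mono_left {O O₁ O₂ : DoubleCone s} (h : O₁.SpacelikeTo O₂) (h' : O.Sub O₁) :
    O.SpacelikeTo O₂ := fun _ hx => h (h' hx)

/-- A point is spacelike to a double cone iff it is neither in the chronological future of the past
vertex nor in the chronological past of the future vertex. -/
theorem mem_causalComplement_iff (O : DoubleCone s) (x : Minkowski s) :
    x ∈ causalComplement O.region ↔
      ¬ InForwardCone (x - O.past) ∧ ¬ InForwardCone (O.future - x) := by
  constructor
  · intro h
    -- The points of the axis close to a vertex belong to the double cone and, the light cone being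
    -- open, remain timelike to `x`.
    have h01 : ∀ᶠ t : ℝ in nhdsWithin 0 (Set.Ioi 0), t < 1 :=
      nhdsWithin_le_nhds (Iio_mem_nhds one_pos)
    have mem : ∀ t : ℝ, 0 < t → t < 1 → O.past + t • (O.future - O.past) ∈ O.region := by
      intro t h0 h1
      refine ⟨by simpa using O.timelike.smul h0, ?_⟩
      have e : O.future - (O.past + t • (O.future - O.past)) = (1 - t) • (O.future - O.past) := by
        module
      rw [e]
      exact O.timelike.smul (by linarith)
    constructor
    · intro hx
      have hc : ContinuousAt (fun t : ℝ => x - (O.past + t • (O.future - O.past))) 0 := by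
        fun_prop
      have hev : ∀ᶠ t : ℝ in nhdsWithin 0 (Set.Ioi 0),
          InForwardCone (x - (O.past + t • (O.future - O.past))) :=
        nhdsWithin_le_nhds (hc (isOpen_inForwardCone.mem_nhds (by simpa using hx)))
      obtain ⟨t, ⟨ht, ht1⟩, ht0⟩ := ((hev.and h01).and self_mem_nhdsWithin).exists
      exact ht.not_spacelike (h _ (mem t ht0 ht1))
    · intro hx
      have hc : ContinuousAt (fun t : ℝ => O.past + (1 - t) • (O.future - O.past) - x) 0 := by
        fun_prop
      have hev : ∀ᶠ t : ℝ in nhdsWithin 0 (Set.Ioi 0),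
          InForwardCone (O.past + (1 - t) • (O.future - O.past) - x) :=
        nhdsWithin_le_nhds (hc (isOpen_inForwardCone.mem_nhds (by simpa using hx)))
      obtain ⟨t, ⟨ht, ht1⟩, ht0⟩ := ((hev.and h01).and self_mem_nhdsWithin).exists
      have ht0' : 0 < t := ht0
      exact ht.not_spacelike (h _ (mem (1 - t) (by linarith) (by linarith))).symm
  · rintro ⟨h1, h2⟩ y ⟨hy1, hy2⟩
    by_contra hs
    simp only [InForwardCone, Spacelike, Prod.fst_sub, Prod.snd_sub, not_lt] at *
    rcases le_total y.1 x.1 with hle | hle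
    · rw [abs_of_nonneg (by linarith)] at hs
      have := norm_sub_le_norm_sub_add_norm_sub x.2 y.2 O.past.2
      linarith
    · rw [abs_of_nonpos (by linarith)] at hs
      have := norm_sub_le_norm_sub_add_norm_sub O.future.2 y.2 x.2
      rw [norm_sub_rev y.2 x.2] at this
      linarith

/-- The interior of the causal complement of a double cone: the points strictly spacelike to its
closure. -/
def exterior (O : DoubleCone s) : Set (Minkowski s) :=
  {x | x.1 - O.past.1 < ‖x.2 - O.past.2‖ ∧ O.future.1 - x.1 < ‖x.2 - O.future.2‖}

theorem isOpen_exterior (O : DoubleCone s) : IsOpen O.exterior :=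
  (isOpen_lt (f := fun x : Minkowski s => x.1 - O.past.1) (g := fun x => ‖x.2 - O.past.2‖)
    (by fun_prop) (by fun_prop)).inter
  (isOpen_lt (f := fun x : Minkowski s => O.future.1 - x.1) (g := fun x => ‖x.2 - O.future.2‖)
    (by fun_prop) (by fun_prop))

theorem exterior_subset (O : DoubleCone s) : O.exterior ⊆ causalComplement O.region := by
  rintro x ⟨h1, h2⟩
  rw [mem_causalComplement_iff]
  simp only [InForwardCone, Prod.fst_sub, Prod.snd_sub, not_lt]
  rw [norm_sub_rev O.future.2]
  exact ⟨h1.le, h2.le⟩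

/-- A double cone is open, so each of its points can be shifted slightly in both time directions
within the causal complement; this makes the weak inequalities strict. -/
theorem SpacelikeTo.subset_exterior {O₁ O : DoubleCone s} (h : O₁.SpacelikeTo O) :
    O₁.region ⊆ O.exterior := by
  intro x hx
  have hc (r : ℝ) : ContinuousAt (fun t : ℝ => x + (t * r, (0 : EuclideanSpace ℝ (Fin s)))) 0 := by
    fun_prop
  have hev (r : ℝ) : ∀ᶠ t : ℝ in nhdsWithin 0 (Set.Ioi 0),
      x + (t * r, (0 : EuclideanSpace ℝ (Fin s))) ∈ O₁.region :=
    nhdsWithin_le_nhds (hc r (O₁.isOpen_region.mem_nhds (by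
      simpa [← Prod.zero_eq_mk] using hx)))
  obtain ⟨t, ht, ht0⟩ := ((hev 1).and self_mem_nhdsWithin).exists
  obtain ⟨t', ht', ht0'⟩ := ((hev (-1)).and self_mem_nhdsWithin).exists
  have h1 := ((mem_causalComplement_iff O _).1 (h ht)).1
  have h2 := ((mem_causalComplement_iff O _).1 (h ht')).2
  simp only [InForwardCone, Prod.fst_sub, Prod.snd_sub, Prod.fst_add, Prod.snd_add, add_zero,
    not_lt] at h1 h2
  rw [norm_sub_rev] at h2
  have a : 0 < t := ht0
  have b : 0 < t' := ht0'
  constructor <;> linarith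

/-- Over a spatial point `v` the exterior is the open time interval from `future.1 - ‖v - Q‖` to
`past.1 + ‖v - P‖`, nonempty exactly when `v` lies outside the ellipsoid with foci `P`, `Q`.
Rescaling these intervals to (-1, 1) exhibits the exterior as a continuous image of a product of
connected sets. -/
theorem isPreconnected_exterior (hs : 2 ≤ s) (O : DoubleCone s) : IsPreconnected O.exterior := by
  have hE : 1 < Module.rank ℝ (EuclideanSpace ℝ (Fin s)) := by
    rw [← Module.finrank_eq_rank, finrank_euclideanSpace_fin]
    exact_mod_cast hs
  set P := O.past.2
  set Q := O.future.2
  have hpre := (isPreconnected_Ioo (a := (-1 : ℝ)) (b := 1)).prod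
    (isPreconnected_ellipsoid_exterior hE P Q (O.future.1 - O.past.1))
  set f : ℝ × EuclideanSpace ℝ (Fin s) → Minkowski s := fun q =>
    ((O.past.1 + ‖q.2 - P‖ + O.future.1 - ‖q.2 - Q‖) / 2
      + q.1 * ((‖q.2 - P‖ + ‖q.2 - Q‖ - (O.future.1 - O.past.1)) / 2), q.2) with hf
  convert hpre.image f (by fun_prop) using 1
  ext x
  constructor
  · rintro ⟨h1, h2⟩
    set w := ‖x.2 - P‖ + ‖x.2 - Q‖ - (O.future.1 - O.past.1) with hw
    have hw0 : 0 < w := by linarith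
    refine ⟨((2 * x.1 - (O.past.1 + ‖x.2 - P‖ + O.future.1 - ‖x.2 - Q‖)) / w, x.2),
      ⟨⟨?_, ?_⟩, ?_⟩, ?_⟩
    · rw [lt_div_iff₀ hw0]; linarith
    · rw [div_lt_iff₀ hw0]; linarith
    · change O.future.1 - O.past.1 < ‖x.2 - P‖ + ‖x.2 - Q‖
      linarith
    · simp only [hf, ← hw]
      ext1
      · field_simp
        ring
      · rfl
  · rintro ⟨⟨r, v⟩, ⟨⟨hr1, hr2⟩, hv⟩, rfl⟩
    change O.future.1 - O.past.1 < ‖v - P‖ + ‖v - Q‖ at hv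
    simp only at hr1 hr2
    set w := ‖v - P‖ + ‖v - Q‖ - (O.future.1 - O.past.1) with hw
    have hw0 : 0 < w := by linarith
    have i1 : r * w < w := by nlinarith
    have i2 : -w < r * w := by nlinarith
    constructor
    · change (O.past.1 + ‖v - P‖ + O.future.1 - ‖v - Q‖) / 2 + r * (w / 2) - O.past.1 < ‖v - P‖
      linarith
    · change O.future.1 - ((O.past.1 + ‖v - P‖ + O.future.1 - ‖v - Q‖) / 2 + r * (w / 2))
        < ‖v - Q‖
      linarith

/-- Double cones form a neighbourhood basis. -/
theorem exists_mem_subset {W : Set (Minkowski s)} (hW : IsOpen W) {x : Minkowski s} (hx : x ∈ W) :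
    ∃ d : DoubleCone s, x ∈ d.region ∧ d.region ⊆ W := by
  obtain ⟨δ, hδ, hball⟩ := Metric.isOpen_iff.1 hW x hx
  refine ⟨⟨x - (δ, 0), x + (δ, 0), ?_⟩, ⟨?_, ?_⟩, fun y hy => hball ?_⟩
  · simp only [InForwardCone, Prod.fst_sub, Prod.snd_sub, Prod.fst_add, Prod.snd_add, sub_zero,
      add_zero, sub_self, norm_zero]
    linarith
  · simpa [InForwardCone] using hδ
  · simpa [InForwardCone] using hδ
  · obtain ⟨h1, h2⟩ := hy
    simp only [InForwardCone, Prod.fst_sub, Prod.snd_sub, Prod.fst_add, Prod.snd_add, sub_zero,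
      add_zero] at h1 h2
    have h3 := norm_nonneg (y.2 - x.2)
    have h4 := norm_nonneg (x.2 - y.2)
    rw [Metric.mem_ball, Prod.dist_eq, max_lt_iff, Real.dist_eq, dist_eq_norm, abs_lt]
    rw [norm_sub_rev] at h2
    refine ⟨⟨by linarith, by linarith⟩, ?_⟩
    rcases le_total y.1 x.1 with h | h <;> linarith

/-- A transitive relation that holds in both directions between comparable double cones spacelike to
`c` holds between any two double cones spacelike to `c`. -/
theorem SpacelikeTo.chain_induction (hs : 2 ≤ s) {c : DoubleCone s}
    (R : DoubleCone s → DoubleCone s → Prop)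
    (htrans : ∀ d e f, d.SpacelikeTo c → e.SpacelikeTo c → f.SpacelikeTo c →
      R d e → R e f → R d f)
    (hsub : ∀ d e, d.Sub e → e.SpacelikeTo c → R d e ∧ R e d)
    {d e : DoubleCone s} (hd : d.SpacelikeTo c) (he : e.SpacelikeTo c) : R d e := by
  -- Quantifying over all double cones around the two points makes `P` a relation on points, to
  -- which induction over a preconnected set applies.
  let P : Minkowski s → Minkowski s → Prop := fun x y =>
    ∀ d e : DoubleCone s, d.SpacelikeTo c → e.SpacelikeTo c → x ∈ d.region → y ∈ e.region → R d e
  obtain ⟨x, hx⟩ := d.region_nonempty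
  obtain ⟨y, hy⟩ := e.region_nonempty
  refine (isPreconnected_exterior hs c).induction₂' P ?_ ?_
    (hd.subset_exterior hx) (he.subset_exterior hy) d e hd he hx hy
  · intro x hx
    obtain ⟨b, hxb, hb⟩ := exists_mem_subset c.isOpen_exterior hx
    have hbc : b.SpacelikeTo c := hb.trans c.exterior_subset
    -- Two overlapping double cones are related through a smaller one inside their intersection.
    have into : ∀ (d : DoubleCone s) (z : Minkowski s), d.SpacelikeTo c → z ∈ d.region →
        z ∈ b.region → R d b ∧ R b d := by
      intro d z hd hzd hzb
      obtain ⟨m, -, hm⟩ := exists_mem_subset (d.isOpen_region.inter b.isOpen_region) ⟨hzd, hzb⟩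
      have hmd : m.Sub d := fun _ h => (hm h).1
      have hmb : m.Sub b := fun _ h => (hm h).2
      have hmc := hd.mono_left hmd
      exact ⟨htrans _ _ _ hd hmc hbc (hsub m d hmd hd).2 (hsub m b hmb hbc).1,
        htrans _ _ _ hbc hmc hd (hsub m b hmb hbc).2 (hsub m d hmd hd).1⟩
    filter_upwards [nhdsWithin_le_nhds (b.isOpen_region.mem_nhds hxb)] with y hyb
    exact ⟨fun d e hd he hxd hye => htrans _ _ _ hd hbc he (into d x hd hxd hxb).1
        (into e y he hye hyb).2,
      fun d e hd he hyd hxe => htrans _ _ _ hd hbc he (into d y hd hyd hyb).1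
        (into e x he hxe hxb).2⟩
  · intro x y z _ hy _ hxy hyz d f hd hf hxd hzf
    obtain ⟨e, hye, he⟩ := exists_mem_subset c.isOpen_exterior hy
    have hec : e.SpacelikeTo c := he.trans c.exterior_subset
    exact htrans _ _ _ hd hec hf (hxy d e hd hec hxd hye) (hyz e f hec hf hye hzf)

/-- A sequence of double cones moving to spatial infinity. -/
def far (hs : 2 ≤ s) (n : ℕ) : DoubleCone s where
  past := (0, EuclideanSpace.single ⟨0, by lia⟩ (n : ℝ))
  future := (1, EuclideanSpace.single ⟨0, by lia⟩ (n : ℝ))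
  timelike := by simp [InForwardCone]

theorem eventually_far_spacelikeTo (hs : 2 ≤ s) (O : DoubleCone s) :
    ∀ᶠ n in Filter.atTop, (far hs n).SpacelikeTo O := by
  have h1 := (tendsto_natCast_atTop_atTop (R := ℝ)).eventually_ge_atTop
    (3 + |O.past.1| + |O.future.1| + ‖O.past.2‖ + ‖O.future.2‖)
  filter_upwards [h1] with n hn x hx
  obtain ⟨hx1, hx2⟩ := hx
  rw [mem_causalComplement_iff]
  simp only [InForwardCone, far, Prod.fst_sub, Prod.snd_sub, not_lt, sub_zero] at *
  set w : EuclideanSpace ℝ (Fin s) := EuclideanSpace.single ⟨0, by lia⟩ (n : ℝ)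
  have hw : ‖w‖ = n := by simp [w]
  have t1 : ‖w‖ ≤ ‖w - x.2‖ + ‖x.2‖ := by simpa using norm_add_le (w - x.2) x.2
  have t2 : ‖x.2‖ ≤ ‖x.2 - O.past.2‖ + ‖O.past.2‖ := by
    simpa using norm_add_le (x.2 - O.past.2) O.past.2
  have t3 : ‖x.2‖ ≤ ‖O.future.2 - x.2‖ + ‖O.future.2‖ := by
    simpa [norm_sub_rev] using norm_add_le (x.2 - O.future.2) O.future.2
  have a1 := neg_abs_le O.past.1
  have a2 := le_abs_self O.future.1
  have p1 := norm_nonneg O.past.2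
  have p2 := norm_nonneg O.future.2
  have p3 := norm_nonneg (x.2 - w)
  have p4 := abs_nonneg O.past.1
  have p5 := abs_nonneg O.future.1
  constructor <;> linarith

/-- Some double cone is spacelike to a given one. -/
theorem exists_spacelikeTo (hs : 2 ≤ s) (O : DoubleCone s) :
    ∃ b : DoubleCone s, b.SpacelikeTo O :=
  let ⟨n, hn⟩ := (eventually_far_spacelikeTo hs O).exists
  ⟨far hs n, hn⟩

end DoubleCone

/-! ### Unitaries and limits of *-homomorphisms. -/

section StarAlgHom

variable {𝔄 : Type u} [CStarAlgebra 𝔄] {𝔅 : Type v} [CStarAlgebra 𝔅]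

/-- The inner automorphism of a unitary, as a unital *-homomorphism. -/
def innerHom (U : 𝔄) (hU : U ∈ unitary 𝔄) : 𝔄 →⋆ₐ[ℂ] 𝔄 where
  toFun x := U * x * star U
  map_one' := by rw [mul_one, (Unitary.mem_iff.1 hU).2]
  map_mul' x y := by
    rw [show U * x * star U * (U * y * star U) = U * x * (star U * U) * y * star U by
      simp only [mul_assoc], (Unitary.mem_iff.1 hU).1, mul_one]
    simp only [mul_assoc]
  map_zero' := by simp
  map_add' x y := by rw [mul_add, add_mul]
  commutes' r := by
    rw [Algebra.algebraMap_eq_smul_one, mul_smul_comm, mul_one, smul_mul_assoc,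
      (Unitary.mem_iff.1 hU).2]
  map_star' x := by simp [mul_assoc]

theorem innerHom_apply (U : 𝔄) (hU : U ∈ unitary 𝔄) (x : 𝔄) :
    innerHom U hU x = U * x * star U := rfl

theorem star_mul_cancel_left_of_mem_unitary {U : 𝔄} (hU : U ∈ unitary 𝔄) (x : 𝔄) :
    star U * (U * x) = x := by
  rw [← mul_assoc, (Unitary.mem_iff.1 hU).1, one_mul]

theorem mul_star_cancel_left_of_mem_unitary {U : 𝔄} (hU : U ∈ unitary 𝔄) (x : 𝔄) :
    U * (star U * x) = x := by
  rw [← mul_assoc, (Unitary.mem_iff.1 hU).2, one_mul]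

theorem mul_left_cancel_of_mem_unitary {U : 𝔄} (hU : U ∈ unitary 𝔄) {x y : 𝔄}
    (h : U * x = U * y) : x = y := by
  rw [← star_mul_cancel_left_of_mem_unitary hU x, h, star_mul_cancel_left_of_mem_unitary hU]

theorem mul_right_cancel_of_mem_unitary {U : 𝔄} (hU : U ∈ unitary 𝔄) {x y : 𝔄}
    (h : x * U = y * U) : x = y := by
  have := congrArg (· * star U) h
  simpa [mul_assoc, (Unitary.mem_iff.1 hU).2] using this

/-- The adjoint of a unitary intertwiner is an intertwiner in the opposite direction. -/
theorem star_intertwines {X : Type*} {U : 𝔄} (hU : U ∈ unitary 𝔄) {ρ σ : X → 𝔄}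
    (h : ∀ x, U * ρ x = σ x * U) (x : X) : star U * σ x = ρ x * star U := by
  apply mul_left_cancel_of_mem_unitary hU
  apply mul_right_cancel_of_mem_unitary hU
  rw [mul_star_cancel_left_of_mem_unitary hU]
  simp only [mul_assoc]
  rw [(Unitary.mem_iff.1 hU).1, mul_one, h]

theorem StarAlgHom.continuous_of_cstar (φ : 𝔄 →⋆ₐ[ℂ] 𝔅) : Continuous φ :=
  AddMonoidHomClass.continuous_of_bound φ 1 fun x => by
    rw [one_mul]
    exact NonUnitalStarAlgHom.norm_apply_le φ x

/-- A sequence of unital *-homomorphisms that is eventually constant at every point of a dense set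
converges pointwise to a unital *-homomorphism. -/
theorem StarAlgHom.exists_tendsto_of_dense {φ : ℕ → 𝔄 →⋆ₐ[ℂ] 𝔅} {D : Set 𝔄} (hD : Dense D)
    (h : ∀ x ∈ D, ∃ y, ∀ᶠ n in Filter.atTop, φ n x = y) :
    ∃ ψ : 𝔄 →⋆ₐ[ℂ] 𝔅, ∀ x, Filter.Tendsto (fun n => φ n x) Filter.atTop (nhds (ψ x)) := by
  have hcauchy (x : 𝔄) : CauchySeq fun n => φ n x := by
    refine Metric.cauchySeq_iff'.2 fun ε hε => ?_
    obtain ⟨d, hdx, hd⟩ := Metric.dense_iff.1 hD x (ε / 2) (by positivity)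
    obtain ⟨y, hy⟩ := h d hd
    obtain ⟨n₀, hn₀⟩ := Filter.eventually_atTop.1 hy
    -- The maps are contractions, so closeness of `x` to `d` passes to the images uniformly in `n`.
    have hle (n : ℕ) : dist (φ n x) (φ n d) ≤ dist d x := by
      rw [dist_eq_norm, dist_eq_norm, ← map_sub, norm_sub_rev d x]
      exact NonUnitalStarAlgHom.norm_apply_le (φ n) (x - d)
    rw [Metric.mem_ball] at hdx
    refine ⟨n₀, fun n hn => ?_⟩
    calc dist (φ n x) (φ n₀ x) ≤ dist (φ n x) (φ n d) + dist (φ n₀ x) (φ n d) :=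
          dist_triangle_right _ _ _
      _ = dist (φ n x) (φ n d) + dist (φ n₀ x) (φ n₀ d) := by rw [hn₀ n hn, hn₀ n₀ le_rfl]
      _ < ε := by linarith [hle n, hle n₀]
  choose f hf using fun x => cauchySeq_tendsto_of_complete (hcauchy x)
  refine ⟨{ toFun := f, map_one' := ?_, map_mul' := ?_, map_zero' := ?_, map_add' := ?_,
            commutes' := ?_, map_star' := ?_ }, hf⟩
  · exact tendsto_nhds_unique (hf 1) (by simp)
  · exact fun x y => tendsto_nhds_unique (hf (x * y)) (by simpa using (hf x).mul (hf y))
  · exact tendsto_nhds_unique (hf 0) (by simp)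
  · exact fun x y => tendsto_nhds_unique (hf (x + y)) (by simpa using (hf x).add (hf y))
  · exact fun r => tendsto_nhds_unique (hf (algebraMap ℂ 𝔄 r)) (by
      simpa only [AlgHomClass.commutes] using tendsto_const_nhds)
  · exact fun x => tendsto_nhds_unique (hf (star x)) (by simpa [map_star] using (hf x).star)

end StarAlgHom

/-! ### Density of the local algebras and relative duality. -/

namespace Net

variable {s : ℕ} {𝔄 : Type u} [CStarAlgebra 𝔄] {𝔅 : Type v} [CStarAlgebra 𝔅] {N : Net s 𝔄}

/-- An identity between continuous functions on the net holds if it holds on the local algebras. -/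
theorem eq_of_eqOn_alg (N : Net s 𝔄) {f g : 𝔄 → 𝔅} (hf : Continuous f) (hg : Continuous g)
    (h : ∀ O, ∀ x ∈ N.alg O, f x = g x) (x : 𝔄) : f x = g x := by
  refine congrFun (Continuous.ext_on N.dense hf hg fun y hy => ?_) x
  obtain ⟨O, hO⟩ := Set.mem_iUnion.1 hy
  exact h O y hO

theorem endo_ext (N : Net s 𝔄) {φ ψ : 𝔄 →⋆ₐ[ℂ] 𝔅} (h : ∀ O, ∀ x ∈ N.alg O, φ x = ψ x) : φ = ψ :=
  StarAlgHom.ext (N.eq_of_eqOn_alg φ.continuous_of_cstar ψ.continuous_of_cstar h)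

theorem RelativeDuality.mem_iff (hN : N.RelativeDuality) {O : DoubleCone s} {x : 𝔄} :
    x ∈ N.alg O ↔ ∀ O₁ : DoubleCone s, O₁.SpacelikeTo O → ∀ y ∈ N.alg O₁, x * y = y * x := by
  rw [← SetLike.mem_coe, hN O]
  rfl

theorem RelativeDuality.commute (hN : N.RelativeDuality) {O O₁ : DoubleCone s}
    (h : O₁.SpacelikeTo O) {x y : 𝔄} (hx : x ∈ N.alg O) (hy : y ∈ N.alg O₁) : x * y = y * x :=
  hN.mem_iff.1 hx O₁ h y hy

/-- Intertwiners between endomorphisms localized in `O` belong to `𝔄(O)`. -/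
theorem RelativeDuality.intertwiner_mem (hN : N.RelativeDuality) {O : DoubleCone s}
    {ρ σ : 𝔄 →⋆ₐ[ℂ] 𝔄} (hρ : N.LocalizedIn ρ O) (hσ : N.LocalizedIn σ O) {T : 𝔄}
    (hT : ∀ x, T * ρ x = σ x * T) : T ∈ N.alg O :=
  hN.mem_iff.2 fun O₁ hO₁ y hy => by
    have := hT y
    rwa [hρ O₁ hO₁ y hy, hσ O₁ hO₁ y hy] at this

/-! ### Path independence of cocycles and the endomorphisms they define. -/

namespace OneCocycle

variable (z : N.OneCocycle)

/-- The value of a cocycle on a pair of double cones; it does not depend on the support. -/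
def arrow (a b : DoubleCone s) : 𝔄 :=
  z.toFun ⟨(DoubleCone.exists_sup a b).choose, a, b,
    (DoubleCone.exists_sup a b).choose_spec.1, (DoubleCone.exists_sup a b).choose_spec.2⟩

/-- By directedness the three supports lie in a common double cone, so any closed triangle of
`1`-simplices bounds a `2`-simplex. -/
theorem toFun_mul (b₀ b₁ b₂ : OneSimplex s) (h₁ : b₀.face0 = b₁.face0) (h₂ : b₀.face1 = b₂.face0)
    (h₃ : b₁.face1 = b₂.face1) : z.toFun b₀ * z.toFun b₂ = z.toFun b₁ := by
  obtain ⟨P, hP₀, hP₁⟩ := DoubleCone.exists_sup b₀.support b₁.support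
  obtain ⟨Q, hQP, hQ₂⟩ := DoubleCone.exists_sup P b₂.support
  obtain ⟨o0, a, b, h0a, h0b⟩ := b₀
  obtain ⟨o1, a', c, h1a, h1c⟩ := b₁
  obtain ⟨o2, b', c', h2b, h2c⟩ := b₂
  obtain rfl : a = a' := h₁
  obtain rfl : b = b' := h₂
  obtain rfl : c = c' := h₃
  exact z.cocycle ⟨Q, o0, o1, o2, a, b, c, hP₀.trans hQP, hP₁.trans hQP, hQ₂, h0a, h0b, h1a, h1c,
    h2b, h2c⟩

/-- The degenerate triangle gives `z(b) z(b) = z(b)`, and `z(b)` is invertible. -/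
theorem toFun_eq_one (b : OneSimplex s) (h : b.face0 = b.face1) : z.toFun b = 1 := by
  have h1 := z.toFun_mul b b b rfl h.symm rfl
  exact mul_left_cancel_of_mem_unitary (z.unitary_mem b) (by rw [h1, mul_one])

theorem toFun_eq_arrow (b : OneSimplex s) : z.toFun b = z.arrow b.face0 b.face1 := by
  have h := z.toFun_mul b ⟨_, b.face0, b.face1, (DoubleCone.exists_sup _ _).choose_spec.1,
    (DoubleCone.exists_sup b.face0 b.face1).choose_spec.2⟩
    ⟨b.support, b.face1, b.face1, b.sub1, b.sub1⟩ rfl rfl rfl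
  rwa [z.toFun_eq_one ⟨b.support, b.face1, b.face1, b.sub1, b.sub1⟩ rfl, mul_one] at h

theorem arrow_mul (a b c : DoubleCone s) : z.arrow a b * z.arrow b c = z.arrow a c :=
  z.toFun_mul _ _ _ rfl rfl rfl

theorem arrow_self (a : DoubleCone s) : z.arrow a a = 1 := z.toFun_eq_one _ rfl

theorem arrow_mem_unitary (a b : DoubleCone s) : z.arrow a b ∈ unitary 𝔄 := z.unitary_mem _

theorem star_arrow (a b : DoubleCone s) : star (z.arrow a b) = z.arrow b a :=
  mul_left_cancel_of_mem_unitary (z.arrow_mem_unitary a b) (by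
    rw [arrow_mul, arrow_self, (Unitary.mem_iff.1 (z.arrow_mem_unitary a b)).2])

theorem arrow_mem_alg {a b O : DoubleCone s} (ha : a.Sub O) (hb : b.Sub O) :
    z.arrow a b ∈ N.alg O := by
  simpa [toFun_eq_arrow] using z.local_mem ⟨O, a, b, ha, hb⟩

/-- The value of a cocycle on two double cones in `c'` lies in any monoid containing the local
algebras of double cones in `c'`. -/
theorem arrow_mem_of_spacelikeTo (hs : 2 ≤ s) {c d e : DoubleCone s} (S : Submonoid 𝔄)
    (hS : ∀ O : DoubleCone s, O.SpacelikeTo c → ∀ x ∈ N.alg O, x ∈ S)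
    (hd : d.SpacelikeTo c) (he : e.SpacelikeTo c) : z.arrow d e ∈ S := by
  -- For comparable double cones the larger one serves as support, so the cocycle value is local in
  -- `c'`.
  refine DoubleCone.SpacelikeTo.chain_induction hs (fun d e => z.arrow d e ∈ S) ?_ ?_ hd he
  · intro d e f _ _ _ h₁ h₂
    rw [← z.arrow_mul d e f]
    exact mul_mem h₁ h₂
  · intro d e hde hec
    exact ⟨hS e hec _ (z.arrow_mem_alg hde (DoubleCone.Sub.refl e)),
      hS e hec _ (z.arrow_mem_alg (DoubleCone.Sub.refl e) hde)⟩

theorem induces_iff {a : DoubleCone s} {ρ : 𝔄 →⋆ₐ[ℂ] 𝔄} :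
    z.Induces a ρ ↔ ∀ O : DoubleCone s, ∀ x ∈ N.alg O, ∀ b : DoubleCone s, b.SpacelikeTo O →
      ρ x = z.arrow a b * x * z.arrow b a := by
  constructor
  · intro h O x hx b hb
    obtain ⟨P, hP₁, hP₂⟩ := DoubleCone.exists_sup a b
    have := h O x hx ⟨P, a, b, hP₁, hP₂⟩ rfl hb
    rwa [toFun_eq_arrow, star_arrow] at this
  · rintro h O x hx b rfl hb
    rw [toFun_eq_arrow, star_arrow]
    exact h O x hx _ hb

/-- Passing from `b` to `b'` inserts `z(b', b)`, a product of elements of local algebras in `O'`; by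
duality it lies in the centralizer of `x`. -/
theorem arrow_conj_eq (hs : 2 ≤ s) (hN : N.RelativeDuality) (a : DoubleCone s)
    {O b b' : DoubleCone s} {x : 𝔄} (hx : x ∈ N.alg O) (hb : b.SpacelikeTo O)
    (hb' : b'.SpacelikeTo O) :
    z.arrow a b * x * z.arrow b a = z.arrow a b' * x * z.arrow b' a := by
  have hmem := z.arrow_mem_of_spacelikeTo hs (Submonoid.centralizer {x})
    (fun P hP y hy => Submonoid.mem_centralizer_iff.2 fun w hw => by
      rw [Set.mem_singleton_iff.1 hw]; exact hN.commute hP hx hy) hb' hb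
  have hcomm : x * z.arrow b' b = z.arrow b' b * x :=
    Submonoid.mem_centralizer_iff.1 hmem x rfl
  rw [← z.arrow_mul a b' b, mul_assoc _ _ x, ← hcomm, ← z.arrow_mul b b' a]
  rw [show z.arrow a b' * (x * z.arrow b' b) * (z.arrow b b' * z.arrow b' a)
    = z.arrow a b' * x * (z.arrow b' b * z.arrow b b') * z.arrow b' a by
      simp only [mul_assoc], arrow_mul, arrow_self, mul_one]

/-- A cocycle defines an endomorphism at every double cone. -/
theorem exists_induces (hs : 2 ≤ s) (hN : N.RelativeDuality) (a : DoubleCone s) :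
    ∃ ρ : 𝔄 →⋆ₐ[ℂ] 𝔄, z.Induces a ρ := by
  -- On each local algebra these inner automorphisms are eventually constant, since the double cones
  -- `far hs n` eventually become spacelike to it.
  let φ : ℕ → 𝔄 →⋆ₐ[ℂ] 𝔄 := fun n =>
    innerHom (z.arrow a (DoubleCone.far hs n)) (z.arrow_mem_unitary _ _)
  have hφ (n : ℕ) (x : 𝔄) :
      φ n x = z.arrow a (DoubleCone.far hs n) * x * z.arrow (DoubleCone.far hs n) a := by
    rw [← z.star_arrow a, ← innerHom_apply _ (z.arrow_mem_unitary _ _)]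
  have hev {O b : DoubleCone s} {x : 𝔄} (hx : x ∈ N.alg O) (hb : b.SpacelikeTo O) :
      ∀ᶠ n in Filter.atTop, φ n x = z.arrow a b * x * z.arrow b a := by
    filter_upwards [DoubleCone.eventually_far_spacelikeTo hs O] with n hn
    rw [hφ]
    exact z.arrow_conj_eq hs hN a hx hn hb
  obtain ⟨ρ, hρ⟩ := StarAlgHom.exists_tendsto_of_dense (φ := φ) N.dense fun x hx => by
    obtain ⟨O, hO⟩ := Set.mem_iUnion.1 hx
    obtain ⟨b, hb⟩ := DoubleCone.exists_spacelikeTo hs O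
    exact ⟨_, hev hO hb⟩
  exact ⟨ρ, z.induces_iff.2 fun O x hx b hb =>
    tendsto_nhds_unique (hρ x) (tendsto_const_nhds.congr' (by
      filter_upwards [hev hx hb] with n hn using hn.symm))⟩

variable {z}

/-- For `O` spacelike to `a` the auxiliary double cone may be `a` itself, where the cocycle equals
1. -/
theorem Induces.localizedIn {a : DoubleCone s} {ρ : 𝔄 →⋆ₐ[ℂ] 𝔄} (h : z.Induces a ρ) :
    N.LocalizedIn ρ a := fun O hO x hx => by
  rw [z.induces_iff.1 h O x hx a hO.symm, arrow_self, one_mul, mul_one]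

/-- The endomorphism defined at another double cone is obtained by conjugation with the cocycle. -/
theorem Induces.conj {a : DoubleCone s} {ρ : 𝔄 →⋆ₐ[ℂ] 𝔄} (h : z.Induces a ρ) (b : DoubleCone s) :
    z.Induces b ((innerHom (z.arrow b a) (z.arrow_mem_unitary b a)).comp ρ) :=
  z.induces_iff.2 fun O x hx c hc => by
    rw [StarAlgHom.comp_apply, z.induces_iff.1 h O x hx c hc, innerHom_apply, star_arrow,
      ← z.arrow_mul b a c, ← z.arrow_mul c a b]
    simp only [mul_assoc]

theorem Induces.conj_intertwines {a : DoubleCone s} (ρ : 𝔄 →⋆ₐ[ℂ] 𝔄) (b : DoubleCone s) (x : 𝔄) :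
    z.arrow b a * ρ x
      = (innerHom (z.arrow b a) (z.arrow_mem_unitary b a)).comp ρ x * z.arrow b a := by
  rw [StarAlgHom.comp_apply, innerHom_apply, star_arrow, mul_assoc _ _ (z.arrow b a), arrow_mul,
    arrow_self, mul_one]

theorem Induces.transportable {a : DoubleCone s} {ρ : 𝔄 →⋆ₐ[ℂ] 𝔄} (h : z.Induces a ρ) :
    N.Transportable ρ := fun b =>
  ⟨_, (h.conj b).localizedIn, z.arrow b a, z.arrow_mem_unitary b a,
    Induces.conj_intertwines ρ b⟩

end OneCocycle

/-- A localized transportable endomorphism gives rise to a cocycle implementing its transport. -/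
theorem Transportable.exists_oneCocycle (hN : N.RelativeDuality) {ρ : 𝔄 →⋆ₐ[ℂ] 𝔄}
    {a : DoubleCone s} (hρ : N.LocalizedIn ρ a) (ht : N.Transportable ρ) :
    ∃ (z : N.OneCocycle) (σ : DoubleCone s → 𝔄 →⋆ₐ[ℂ] 𝔄), (∀ b, N.LocalizedIn (σ b) b) ∧
      ∀ b x, z.arrow b a * ρ x = σ b x * z.arrow b a := by
  have h (b : DoubleCone s) : ∃ (σ : 𝔄 →⋆ₐ[ℂ] 𝔄) (U : 𝔄), N.LocalizedIn σ b ∧ U ∈ unitary 𝔄 ∧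
      -- Normalizing the transport at `a` to 1 makes `z.arrow b a` equal to `U b` itself.
      (∀ x, U * ρ x = σ x * U) ∧ (b = a → U = 1) := by
    by_cases hb : b = a
    · subst hb
      exact ⟨ρ, 1, hρ, one_mem _, fun x => by rw [one_mul, mul_one], fun _ => rfl⟩
    · obtain ⟨σ, hσ, U, hU, hUσ⟩ := ht b
      exact ⟨σ, U, hσ, hU, hUσ, fun h => absurd h hb⟩
  choose σ U hσ hU hUσ hUa using h
  let z : N.OneCocycle :=
    { toFun := fun b => U b.face0 * star (U b.face1)
      unitary_mem := fun b => mul_mem (hU _) (Unitary.star_mem (hU _))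
      local_mem := fun b => by
        -- `U b.face0 * star (U b.face1)` intertwines two endomorphisms localized in the support, so
        -- duality places it in the local algebra.
        refine hN.intertwiner_mem ((hσ b.face1).mono b.sub1) ((hσ b.face0).mono b.sub0) fun x => ?_
        rw [mul_assoc, star_intertwines (hU _) (hUσ _), ← mul_assoc, hUσ, mul_assoc]
      cocycle := fun c => by
        change U c.o01 * star (U c.o02) * (U c.o02 * star (U c.o12)) = U c.o01 * star (U c.o12)
        rw [mul_assoc, star_mul_cancel_left_of_mem_unitary (hU _)] }
  refine ⟨z, σ, hσ, fun b x => ?_⟩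
  have hz : z.arrow b a = U b := by
    change U b * star (U a) = U b
    rw [hUa a rfl, star_one, mul_one]
  rw [hz, hUσ]

/-- The transported endomorphism `σ b` fixes 𝔄(O) when `b` is spacelike to `O`; undoing the
transport gives the defining formula. -/
theorem Transportable.exists_induces (hN : N.RelativeDuality) {ρ : 𝔄 →⋆ₐ[ℂ] 𝔄}
    {a : DoubleCone s} (hρ : N.LocalizedIn ρ a) (ht : N.Transportable ρ) :
    ∃ z : N.OneCocycle, z.Induces a ρ := by
  obtain ⟨z, σ, hσ, hz⟩ := ht.exists_oneCocycle hN hρ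
  refine ⟨z, z.induces_iff.2 fun O x hx b hb => ?_⟩
  apply mul_left_cancel_of_mem_unitary (z.arrow_mem_unitary b a)
  rw [hz, hσ b O hb.symm x hx, mul_assoc, ← mul_assoc, z.arrow_mul, z.arrow_self, one_mul]

/-- Intertwiners between transportable endomorphisms localized spacelike to `c` are fixed by
endomorphisms localized in `c`. -/
theorem LocalizedIn.map_intertwiner (hs : 2 ≤ s) (hN : N.RelativeDuality)
    {ρ σ τ : 𝔄 →⋆ₐ[ℂ] 𝔄} {c d e : DoubleCone s} (hρ : N.LocalizedIn ρ c)
    (hσ : N.LocalizedIn σ d) (hτ : N.LocalizedIn τ e) (hd : d.SpacelikeTo c)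
    (he : e.SpacelikeTo c) (ht : N.Transportable σ) {T : 𝔄} (hT : ∀ x, T * σ x = τ x * T) :
    ρ T = T := by
  obtain ⟨z, σ', hσ', hz⟩ := ht.exists_oneCocycle hN hσ
  have hU := z.arrow_mem_unitary e d
  -- `T` factors as an intertwiner local in `e` times the charge transporter from `d` to `e`. The
  -- transporter is a product along a chain in `c'`, and the elements fixed by `ρ` form a monoid.
  have h1 : ρ (z.arrow e d) = z.arrow e d :=
    z.arrow_mem_of_spacelikeTo hs (MonoidHom.eqLocusM (ρ : 𝔄 →* 𝔄) (MonoidHom.id 𝔄))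
      (fun O hO x hx => hρ O hO x hx) he hd
  have h2 : T * star (z.arrow e d) ∈ N.alg e := by
    refine hN.intertwiner_mem (hσ' e) hτ fun x => ?_
    rw [mul_assoc, star_intertwines hU (hz e), ← mul_assoc, hT, mul_assoc]
  have h3 : T = T * star (z.arrow e d) * z.arrow e d := by
    rw [mul_assoc, (Unitary.mem_iff.1 hU).1, mul_one]
  rw [h3, map_mul, h1, hρ e he _ h2]

/-- Endomorphisms localized in spacelike separated double cones commute. -/
theorem LocalizedIn.comm (hs : 2 ≤ s) (hN : N.RelativeDuality) {ρ σ : 𝔄 →⋆ₐ[ℂ] 𝔄}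
    {c d : DoubleCone s} (hρ : N.LocalizedIn ρ c) (hσ : N.LocalizedIn σ d)
    (hcd : c.SpacelikeTo d) (hρt : N.Transportable ρ) (hσt : N.Transportable σ) (x : 𝔄) :
    ρ (σ x) = σ (ρ x) := by
  refine N.eq_of_eqOn_alg (ρ.continuous_of_cstar.comp σ.continuous_of_cstar)
    (σ.continuous_of_cstar.comp ρ.continuous_of_cstar) (fun O x hx => ?_) x
  change ρ (σ x) = σ (ρ x)
  -- First `σ` is moved to `d'`, spacelike to both `O` and `c`, by some `V` fixed by `ρ`. Then `ρ`
  -- is moved to `c'`, spacelike to both `O` and `d'`, by some `U` fixed by `σ'`.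
  obtain ⟨P, hOP, hcP⟩ := DoubleCone.exists_sup O c
  obtain ⟨d', hd'⟩ := DoubleCone.exists_spacelikeTo hs P
  obtain ⟨σ', hσ', V, hV, hVσ⟩ := hσt d'
  have hd'c := hd'.mono hcP
  have hρV := hρ.map_intertwiner hs hN hσ hσ' hcd.symm hd'c hσt hVσ
  obtain ⟨Q, hOQ, hdQ⟩ := DoubleCone.exists_sup O d'
  obtain ⟨c', hc'⟩ := DoubleCone.exists_spacelikeTo hs Q
  obtain ⟨ρ', hρ', U, hU, hUρ⟩ := hρt c'
  have hσU := hσ'.map_intertwiner hs hN hρ hρ' hd'c.symm (hc'.mono hdQ) hρt hUρ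
  have h1 : σ' x = x := hσ' O (hd'.mono hOP).symm x hx
  have h2 : ρ' x = x := hρ' O (hc'.mono hOQ).symm x hx
  -- Here `ρ x = U* x U`, and `σ'` fixes both `U` and `x`.
  have h3 : σ' (ρ x) = ρ x := by
    apply mul_left_cancel_of_mem_unitary hU
    have := congrArg σ' (hUρ x)
    rw [map_mul, map_mul, hσU, h2, h1] at this
    rw [this, hUρ, h2]
  apply mul_left_cancel_of_mem_unitary hV
  have := congrArg ρ (hVσ x)
  rw [map_mul, map_mul, hρV, h1] at this
  rw [this, hVσ, h3]

end Net

/-! ### The canonical permutation symmetry. -/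

namespace Net

variable {s : ℕ} {𝔄 : Type u} [CStarAlgebra 𝔄] {N : Net s 𝔄}

namespace Tt

/-- A transportable endomorphism is unitarily equivalent to an object localized in a given double
cone. -/
theorem exists_localizedIn (ρ : Tt N) (O : DoubleCone s) :
    ∃ (σ : Tt N) (U : ρ ⟶ σ), N.LocalizedIn σ.endo O ∧ elem U ∈ unitary 𝔄 := by
  obtain ⟨σ, hσ, U, hU, h⟩ := ρ.transportable O
  refine ⟨⟨σ, ⟨O, hσ⟩, fun P => ?_⟩, ofElem U h, hσ, hU⟩
  obtain ⟨τ, hτ, V, hV, h'⟩ := ρ.transportable P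
  refine ⟨τ, hτ, V * star U, mul_mem hV (Unitary.star_mem hU), fun x => ?_⟩
  rw [mul_assoc, star_intertwines hU h, ← mul_assoc, h', mul_assoc]

/-- The exchange operator does not depend on the transport of the second factor. -/
theorem exchange_eq_right (hs : 2 ≤ s) (hN : N.RelativeDuality) {ρ σ ρ₁ σ₂ σ₃ : Tt N}
    {c d e : DoubleCone s} (hd : d.SpacelikeTo c) (he : e.SpacelikeTo c)
    (hρ₁ : N.LocalizedIn ρ₁.endo c) (hσ₂ : N.LocalizedIn σ₂.endo d)
    (hσ₃ : N.LocalizedIn σ₃.endo e) (U₁ : ρ ⟶ ρ₁) (U₂ : σ ⟶ σ₂) (U₃ : σ ⟶ σ₃)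
    (h₂ : elem U₂ ∈ unitary 𝔄) (h₃ : elem U₃ ∈ unitary 𝔄) :
    star (elem (U₂ ⊗ₘ U₁)) * elem (U₁ ⊗ₘ U₂) = star (elem (U₃ ⊗ₘ U₁)) * elem (U₁ ⊗ₘ U₃) := by
  set W : 𝔄 := elem U₃ * star (elem U₂) with hW
  have hWU : W * elem U₂ = elem U₃ := by
    rw [hW, mul_assoc, (Unitary.mem_iff.1 h₂).1, mul_one]
  have hWu : W ∈ unitary 𝔄 := mul_mem h₃ (Unitary.star_mem h₂)
  -- `W` intertwines `σ₂` and `σ₃`, both localized spacelike to `c`, so it passes through `ρ₁`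
  -- unchanged and cancels.
  have hρW : ρ₁.endo W = W :=
    hρ₁.map_intertwiner hs hN hσ₂ hσ₃ hd he σ₂.transportable fun x => by
      rw [mul_assoc, star_intertwines h₂ (elem_intertwines U₂), ← mul_assoc, elem_intertwines,
        mul_assoc]
  simp only [elem_tensorHom, elem_intertwines U₁, star_mul, ← hWU]
  rw [map_mul ρ₁.endo, hρW]
  simp only [mul_assoc]
  rw [star_mul_cancel_left_of_mem_unitary hWu]

/-- The exchange operator does not depend on the transport of the first factor. -/
theorem exchange_eq_left (hs : 2 ≤ s) (hN : N.RelativeDuality) {ρ σ ρ₁ σ₂ ρ₃ : Tt N}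
    {c d e : DoubleCone s} (hd : d.SpacelikeTo c) (he : e.SpacelikeTo c)
    (hσ₂ : N.LocalizedIn σ₂.endo c) (hρ₁ : N.LocalizedIn ρ₁.endo d)
    (hρ₃ : N.LocalizedIn ρ₃.endo e) (U₁ : ρ ⟶ ρ₁) (U₂ : σ ⟶ σ₂) (U₃ : ρ ⟶ ρ₃)
    (h₁ : elem U₁ ∈ unitary 𝔄) (h₃ : elem U₃ ∈ unitary 𝔄) :
    star (elem (U₂ ⊗ₘ U₁)) * elem (U₁ ⊗ₘ U₂) = star (elem (U₂ ⊗ₘ U₃)) * elem (U₃ ⊗ₘ U₂) := by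
  -- Taking adjoints interchanges the roles of the two factors.
  have h := congrArg star (exchange_eq_right hs hN hd he hσ₂ hρ₁ hρ₃ U₂ U₁ U₃ h₁ h₃)
  simpa only [star_mul, star_star] using h

/-- The exchange operator does not depend on any choice. -/
theorem exchange_eq (hs : 2 ≤ s) (hN : N.RelativeDuality) {ρ σ ρ₁ σ₂ ρ₃ σ₄ : Tt N}
    {O₁ O₂ O₃ O₄ : DoubleCone s} (h₁₂ : O₁.SpacelikeTo O₂) (h₃₄ : O₃.SpacelikeTo O₄)
    (hρ₁ : N.LocalizedIn ρ₁.endo O₁) (hσ₂ : N.LocalizedIn σ₂.endo O₂)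
    (hρ₃ : N.LocalizedIn ρ₃.endo O₃) (hσ₄ : N.LocalizedIn σ₄.endo O₄)
    (U₁ : ρ ⟶ ρ₁) (U₂ : σ ⟶ σ₂) (U₃ : ρ ⟶ ρ₃) (U₄ : σ ⟶ σ₄)
    (h₁ : elem U₁ ∈ unitary 𝔄) (h₂ : elem U₂ ∈ unitary 𝔄)
    (h₃ : elem U₃ ∈ unitary 𝔄) (h₄ : elem U₄ ∈ unitary 𝔄) :
    star (elem (U₂ ⊗ₘ U₁)) * elem (U₁ ⊗ₘ U₂) = star (elem (U₄ ⊗ₘ U₃)) * elem (U₃ ⊗ₘ U₄) := by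
  -- With `σ` parked at `e`, spacelike to both `O₁` and `O₃`, the transports can be replaced one
  -- factor at a time.
  obtain ⟨P, hP₁, hP₃⟩ := DoubleCone.exists_sup O₁ O₃
  obtain ⟨e, he⟩ := DoubleCone.exists_spacelikeTo hs P
  obtain ⟨τ, V, hτ, hV⟩ := exists_localizedIn σ e
  rw [exchange_eq_right hs hN h₁₂.symm (he.mono hP₁) hρ₁ hσ₂ hτ U₁ U₂ V h₂ hV,
    exchange_eq_left hs hN (he.mono hP₁).symm (he.mono hP₃).symm hτ hρ₁ hρ₃ U₁ V U₃ h₁ h₃,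
    exchange_eq_right hs hN (he.mono hP₃) h₃₄.symm hρ₃ hτ hσ₄ U₃ V U₄ hV h₄]

theorem exists_exchange (hs : 2 ≤ s) (hN : N.RelativeDuality) (ρ σ : Tt N) :
    ∃ T : 𝔄, ∀ (ρ₁ σ₂ : Tt N) (O₁ O₂ : DoubleCone s), O₁.SpacelikeTo O₂ →
      N.LocalizedIn ρ₁.endo O₁ → N.LocalizedIn σ₂.endo O₂ →
      ∀ (U₁ : ρ ⟶ ρ₁) (U₂ : σ ⟶ σ₂), elem U₁ ∈ unitary 𝔄 → elem U₂ ∈ unitary 𝔄 →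
        T = star (elem (U₂ ⊗ₘ U₁)) * elem (U₁ ⊗ₘ U₂) := by
  obtain ⟨c, hc⟩ := ρ.localized
  obtain ⟨d, hd⟩ := DoubleCone.exists_spacelikeTo hs c
  obtain ⟨τ, V, hτ, hV⟩ := exists_localizedIn σ d
  exact ⟨_, fun ρ₁ σ₂ O₁ O₂ h hρ₁ hσ₂ U₁ U₂ h₁ h₂ =>
    exchange_eq hs hN hd.symm h hc hτ hρ₁ hσ₂ (𝟙 ρ) V U₁ U₂ (one_mem _) hV h₁ h₂⟩

/-- The exchange operator of two objects. -/
def exchange (hs : 2 ≤ s) (hN : N.RelativeDuality) (ρ σ : Tt N) : 𝔄 :=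
  (exists_exchange hs hN ρ σ).choose

/-- Any object can be transported to the spacelike complement of a double cone. -/
theorem exists_spacelike_transport (hs : 2 ≤ s) (σ : Tt N) (c : DoubleCone s) :
    ∃ (d : DoubleCone s) (τ : Tt N) (U : σ ⟶ τ), d.SpacelikeTo c ∧ N.LocalizedIn τ.endo d ∧
      elem U ∈ unitary 𝔄 := by
  obtain ⟨d, hd⟩ := DoubleCone.exists_spacelikeTo hs c
  obtain ⟨τ, U, hτ, hU⟩ := exists_localizedIn σ d
  exact ⟨d, τ, U, hd, hτ, hU⟩

section

variable (hs : 2 ≤ s) (hN : N.RelativeDuality)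

theorem exchange_spec {ρ σ ρ₁ σ₂ : Tt N} {O₁ O₂ : DoubleCone s} (h : O₁.SpacelikeTo O₂)
    (hρ₁ : N.LocalizedIn ρ₁.endo O₁) (hσ₂ : N.LocalizedIn σ₂.endo O₂) (U₁ : ρ ⟶ ρ₁) (U₂ : σ ⟶ σ₂)
    (h₁ : elem U₁ ∈ unitary 𝔄) (h₂ : elem U₂ ∈ unitary 𝔄) :
    exchange hs hN ρ σ = star (elem (U₂ ⊗ₘ U₁)) * elem (U₁ ⊗ₘ U₂) :=
  (exists_exchange hs hN ρ σ).choose_spec ρ₁ σ₂ O₁ O₂ h hρ₁ hσ₂ U₁ U₂ h₁ h₂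

/-- Only the second factor is moved, which reduces the symmetry axioms to computations with a single
unitary. -/
theorem exchange_eq_star_mul_map {ρ σ τ : Tt N} {c d : DoubleCone s} (h : d.SpacelikeTo c)
    (hρ : N.LocalizedIn ρ.endo c) (hτ : N.LocalizedIn τ.endo d) (U : σ ⟶ τ)
    (hU : elem U ∈ unitary 𝔄) : exchange hs hN ρ σ = star (elem U) * ρ.endo (elem U) := by
  rw [exchange_spec hs hN h.symm hρ hτ (𝟙 ρ) U (one_mem _) hU]
  simp

theorem star_exchange (ρ σ : Tt N) : star (exchange hs hN ρ σ) = exchange hs hN σ ρ := by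
  obtain ⟨c, hc⟩ := ρ.localized
  obtain ⟨d, τ, U, hd, hτ, hU⟩ := exists_spacelike_transport hs σ c
  rw [exchange_spec hs hN hd.symm hc hτ (𝟙 ρ) U (one_mem _) hU,
    exchange_spec hs hN hd hτ hc U (𝟙 ρ) hU (one_mem _), star_mul, star_star]

theorem exchange_mem_unitary (ρ σ : Tt N) : exchange hs hN ρ σ ∈ unitary 𝔄 := by
  obtain ⟨c, hc⟩ := ρ.localized
  obtain ⟨d, τ, U, hd, hτ, hU⟩ := exists_spacelike_transport hs σ c
  rw [exchange_eq_star_mul_map hs hN hd hc hτ U hU]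
  exact mul_mem (Unitary.star_mem hU) (Unitary.map_mem ρ.endo hU)

theorem exchange_mul_exchange (ρ σ : Tt N) : exchange hs hN σ ρ * exchange hs hN ρ σ = 1 := by
  rw [← star_exchange, (Unitary.mem_iff.1 (exchange_mem_unitary hs hN ρ σ)).1]

/-- After `σ` is moved to `τ`, spacelike to `ρ`, this is the commutativity of `ρ` and `τ`. -/
theorem exchange_intertwines (ρ σ : Tt N) (x : 𝔄) :
    exchange hs hN ρ σ * (ρ ⊗ σ).endo x = (σ ⊗ ρ).endo x * exchange hs hN ρ σ := by
  obtain ⟨c, hc⟩ := ρ.localized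
  obtain ⟨d, τ, U, hd, hτ, hU⟩ := exists_spacelike_transport hs σ c
  rw [exchange_eq_star_mul_map hs hN hd hc hτ U hU]
  simp only [endo_tensor, StarAlgHom.comp_apply]
  rw [mul_assoc, ← map_mul, elem_intertwines, map_mul, ← mul_assoc,
    hc.comm hs hN hτ hd.symm ρ.transportable τ.transportable,
    star_intertwines hU (elem_intertwines U), mul_assoc]

/-- A single transport of `σ` to `τ` serves both `ρ` and `ρ'`; duality makes `f` local in `P`, so
`τ` fixes it. -/
theorem exchange_natural_left {ρ ρ' : Tt N} (f : ρ ⟶ ρ') (σ : Tt N) :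
    exchange hs hN ρ' σ * elem f = σ.endo (elem f) * exchange hs hN ρ σ := by
  obtain ⟨c, hc⟩ := ρ.localized
  obtain ⟨c', hc'⟩ := ρ'.localized
  obtain ⟨P, hP, hP'⟩ := DoubleCone.exists_sup c c'
  obtain ⟨d, τ, U, hd, hτ, hU⟩ := exists_spacelike_transport hs σ P
  have hf : elem f ∈ N.alg P :=
    hN.intertwiner_mem (hc.mono hP) (hc'.mono hP') (elem_intertwines f)
  rw [exchange_eq_star_mul_map hs hN hd (hc.mono hP) hτ U hU,
    exchange_eq_star_mul_map hs hN hd (hc'.mono hP') hτ U hU, mul_assoc, ← elem_intertwines f,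
    ← mul_assoc (σ.endo _), ← star_intertwines hU (elem_intertwines U), hτ P hd.symm _ hf,
    mul_assoc]

theorem exchange_natural_right (ρ : Tt N) {σ σ' : Tt N} (g : σ ⟶ σ') :
    exchange hs hN ρ σ' * ρ.endo (elem g) = elem g * exchange hs hN ρ σ := by
  have h := congrArg star (exchange_natural_left hs hN (adjoint g) ρ)
  rw [star_mul, star_mul, ← map_star, star_exchange, star_exchange] at h
  simpa [adjoint] using h.symm

/-- With a common `U` the factors `ρ(U)` and `ρ(U*)` cancel, leaving `U* ρρ'(U)`. -/
theorem exchange_tensor_left (ρ ρ' σ : Tt N) :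
    exchange hs hN (ρ ⊗ ρ') σ = exchange hs hN ρ σ * ρ.endo (exchange hs hN ρ' σ) := by
  obtain ⟨c, hc⟩ := ρ.localized
  obtain ⟨c', hc'⟩ := ρ'.localized
  obtain ⟨P, hP, hP'⟩ := DoubleCone.exists_sup c c'
  obtain ⟨d, τ, U, hd, hτ, hU⟩ := exists_spacelike_transport hs σ P
  rw [exchange_eq_star_mul_map hs hN hd (hc.mono hP) hτ U hU,
    exchange_eq_star_mul_map hs hN hd (hc'.mono hP') hτ U hU,
    exchange_eq_star_mul_map hs hN hd ((hc.mono hP).comp (hc'.mono hP') :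
      N.LocalizedIn (ρ ⊗ ρ').endo P) hτ U hU]
  rw [map_mul, mul_assoc, ← mul_assoc (ρ.endo _), ← map_mul, (Unitary.mem_iff.1 hU).2, map_one,
    one_mul, endo_tensor, StarAlgHom.comp_apply]

theorem exchange_tensor_right (ρ σ σ' : Tt N) :
    exchange hs hN ρ (σ ⊗ σ') = σ.endo (exchange hs hN ρ σ') * exchange hs hN ρ σ := by
  have h := congrArg star (exchange_tensor_left hs hN σ σ' ρ)
  rwa [star_mul, ← map_star, star_exchange, star_exchange, star_exchange] at h

@[simp] theorem elem_associator_inv (ρ σ τ : Tt N) : elem (α_ ρ σ τ).inv = 1 := rfl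

/-- The isomorphism given by an invertible intertwiner. -/
def isoOfElem {ρ σ : Tt N} (T T' : 𝔄) (h : ∀ x, T * ρ.endo x = σ.endo x * T)
    (h' : ∀ x, T' * σ.endo x = ρ.endo x * T') (h₁ : T' * T = 1) (h₂ : T * T' = 1) : ρ ≅ σ where
  hom := ofElem T h
  inv := ofElem T' h'
  hom_inv_id := hom_ext h₁
  inv_hom_id := hom_ext h₂

/-- The canonical permutation symmetry. -/
@[reducible] def canonicalSymmetry : SymmetricCategory (Tt N) where
  braiding ρ σ := isoOfElem (exchange hs hN ρ σ) (exchange hs hN σ ρ)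
    (exchange_intertwines hs hN ρ σ) (exchange_intertwines hs hN σ ρ)
    (exchange_mul_exchange hs hN ρ σ) (exchange_mul_exchange hs hN σ ρ)
  braiding_naturality_right ρ _ _ g := hom_ext (exchange_natural_right hs hN ρ g)
  braiding_naturality_left f σ := hom_ext (exchange_natural_left hs hN f σ)
  hexagon_forward ρ σ τ := hom_ext (by
    simpa [isoOfElem] using exchange_tensor_right hs hN ρ σ τ)
  hexagon_reverse ρ σ τ := hom_ext (by
    simpa [isoOfElem] using exchange_tensor_left hs hN ρ σ τ)
  symmetry ρ σ := hom_ext (exchange_mul_exchange hs hN ρ σ)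

theorem isCanonicalSymmetry_canonicalSymmetry :
    IsCanonicalSymmetry N (canonicalSymmetry hs hN) :=
  fun _ _ _ _ _ _ h hρ₁ hσ₂ U₁ U₂ h₁ h₂ => exchange_spec hs hN h hρ₁ hσ₂ U₁ U₂ h₁ h₂

end

end Tt

end Net

/-! ### The extension of endomorphisms along an inclusion of nets, and its functoriality. -/

namespace Net

variable {s : ℕ} {𝔄 : Type u} [CStarAlgebra 𝔄] {𝔅 : Type v} [CStarAlgebra 𝔅]
  {A : Net s 𝔄} {B : Net s 𝔅}

namespace Inclusion

variable (i : A.Inclusion B)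

/-- `ψ` is the canonical extension of the endomorphism `ρ`: on `𝔅(O)` it is implemented by the
unitaries transporting `ρ` to the spacelike complement of `O`. -/
def IsExtension (ρ : 𝔄 →⋆ₐ[ℂ] 𝔄) (ψ : 𝔅 →⋆ₐ[ℂ] 𝔅) : Prop :=
  ∀ (O b : DoubleCone s), b.SpacelikeTo O → ∀ σ : 𝔄 →⋆ₐ[ℂ] 𝔄, A.LocalizedIn σ b →
    ∀ U ∈ unitary 𝔄, (∀ x, U * ρ x = σ x * U) → ∀ X ∈ B.alg O, i.hom U * ψ X = X * i.hom U

variable {i}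

/-- The endomorphism defined by the image of a cocycle extends the one defined by the cocycle. -/
theorem isExtension_of_induces (hA : A.RelativeDuality) (hB : B.RelativeDuality)
    {z : A.OneCocycle} {a : DoubleCone s} {ρ : 𝔄 →⋆ₐ[ℂ] 𝔄} {ψ : 𝔅 →⋆ₐ[ℂ] 𝔅} (hρ : z.Induces a ρ)
    (hψ : (z.map i).Induces a ψ) : i.IsExtension ρ ψ := by
  intro O b hb σ hσ U hU h X hX
  -- An arbitrary transport to `b` differs from the cocycle's by an element of 𝔄(b), whose image
  -- commutes with `X`.
  have hmem : U * z.arrow a b ∈ A.alg b := by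
    refine hA.intertwiner_mem (hρ.conj b).localizedIn hσ fun x => ?_
    have h' := star_intertwines (z.arrow_mem_unitary b a)
      (OneCocycle.Induces.conj_intertwines (z := z) (a := a) ρ b) x
    rw [z.star_arrow] at h'
    rw [mul_assoc, h', ← mul_assoc, h, mul_assoc]
  have hX' : ψ X = i.hom (z.arrow a b) * X * i.hom (z.arrow b a) :=
    (z.map i).induces_iff.1 hψ O X hX b hb
  rw [hX', ← mul_assoc, ← mul_assoc, ← map_mul,
    ← hB.commute hb hX (i.map_mem b _ hmem), mul_assoc, ← map_mul, mul_assoc U, z.arrow_mul,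
    z.arrow_self, mul_one]

theorem exists_isExtension (hs : 2 ≤ s) (hA : A.RelativeDuality) (hB : B.RelativeDuality)
    (ρ : A.Tt) : ∃ ψ, i.IsExtension ρ.endo ψ := by
  obtain ⟨a, ha⟩ := ρ.localized
  obtain ⟨z, hz⟩ := ρ.transportable.exists_induces hA ha
  obtain ⟨ψ, hψ⟩ := (z.map i).exists_induces hs hB a
  exact ⟨ψ, isExtension_of_induces hA hB hz hψ⟩

namespace IsExtension

/-- If `O` is spacelike to `a`, then `ρ` is its own transport, with unitary 1. -/
theorem localizedIn {ρ : 𝔄 →⋆ₐ[ℂ] 𝔄} {ψ : 𝔅 →⋆ₐ[ℂ] 𝔅} (h : i.IsExtension ρ ψ)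
    {a : DoubleCone s} (ha : A.LocalizedIn ρ a) : B.LocalizedIn ψ a := by
  intro O hO X hX
  simpa using h O a hO.symm ρ ha 1 (one_mem _) (by simp) X hX

theorem induces {ρ : 𝔄 →⋆ₐ[ℂ] 𝔄} {ψ : 𝔅 →⋆ₐ[ℂ] 𝔅} (h : i.IsExtension ρ ψ)
    {z : A.OneCocycle} {a : DoubleCone s} (hz : z.Induces a ρ) : (z.map i).Induces a ψ := by
  refine (z.map i).induces_iff.2 fun O X hX b hb => ?_
  have h1 := h O b hb _ (hz.conj b).localizedIn _ (z.arrow_mem_unitary b a)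
    (OneCocycle.Induces.conj_intertwines ρ b) X hX
  change ψ X = i.hom (z.arrow a b) * X * i.hom (z.arrow b a)
  rw [mul_assoc, ← h1, ← mul_assoc, ← map_mul, z.arrow_mul, z.arrow_self, map_one, one_mul]

/-- Once both endomorphisms are moved to `b` in `O'`, the arrow `T` becomes `W = V T U*` in 𝔄(b),
and its image commutes with 𝔅(O). -/
theorem intertwines (hs : 2 ≤ s) (hA : A.RelativeDuality) (hB : B.RelativeDuality)
    {ρ σ : A.Tt} {ψ χ : 𝔅 →⋆ₐ[ℂ] 𝔅} (hψ : i.IsExtension ρ.endo ψ) (hχ : i.IsExtension σ.endo χ)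
    (T : ρ ⟶ σ) (X : 𝔅) : i.hom (Tt.elem T) * ψ X = χ X * i.hom (Tt.elem T) := by
  refine B.eq_of_eqOn_alg (f := fun X => i.hom (Tt.elem T) * ψ X)
    (g := fun X => χ X * i.hom (Tt.elem T)) (continuous_const.mul ψ.continuous_of_cstar)
    (χ.continuous_of_cstar.mul continuous_const) (fun O X hX => ?_) X
  obtain ⟨b, hb⟩ := DoubleCone.exists_spacelikeTo hs O
  obtain ⟨ρ', U, hρ', hU⟩ := ρ.exists_localizedIn b
  obtain ⟨σ', V, hσ', hV⟩ := σ.exists_localizedIn b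
  have h1 := hψ O b hb _ hρ' _ hU (Tt.elem_intertwines U) X hX
  have h2 := hχ O b hb _ hσ' _ hV (Tt.elem_intertwines V) X hX
  set W : 𝔄 := Tt.elem V * Tt.elem T * star (Tt.elem U) with hW
  have hWU : W * Tt.elem U = Tt.elem V * Tt.elem T := by
    rw [hW, mul_assoc, (Unitary.mem_iff.1 hU).1, mul_one]
  have hWb : W ∈ A.alg b := by
    refine hA.intertwiner_mem hρ' hσ' fun x => ?_
    rw [hW, mul_assoc, star_intertwines hU (Tt.elem_intertwines U), ← mul_assoc,
      mul_assoc _ (Tt.elem T), Tt.elem_intertwines, ← mul_assoc, Tt.elem_intertwines]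
    simp only [mul_assoc]
  refine mul_left_cancel_of_mem_unitary (Unitary.map_mem i.hom hV) ?_
  rw [← mul_assoc, ← map_mul, ← hWU, map_mul, mul_assoc, h1, ← mul_assoc,
    ← hB.commute hb hX (i.map_mem b _ hWb), mul_assoc, ← map_mul, hWU, ← mul_assoc, h2, map_mul,
    mul_assoc]

theorem unique (hs : 2 ≤ s) (hA : A.RelativeDuality) (hB : B.RelativeDuality)
    {ρ : A.Tt} {ψ χ : 𝔅 →⋆ₐ[ℂ] 𝔅} (hψ : i.IsExtension ρ.endo ψ) (hχ : i.IsExtension ρ.endo χ) :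
    ψ = χ :=
  StarAlgHom.ext fun X => by simpa using hψ.intertwines hs hA hB hχ (𝟙 ρ) X

theorem apply_hom (hs : 2 ≤ s) {ρ : A.Tt} {ψ : 𝔅 →⋆ₐ[ℂ] 𝔅} (hψ : i.IsExtension ρ.endo ψ) (x : 𝔄) :
    ψ (i.hom x) = i.hom (ρ.endo x) := by
  refine A.eq_of_eqOn_alg (ψ.continuous_of_cstar.comp i.hom.continuous_of_cstar)
    (i.hom.continuous_of_cstar.comp ρ.endo.continuous_of_cstar) (fun O x hx => ?_) x
  obtain ⟨b, hb⟩ := DoubleCone.exists_spacelikeTo hs O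
  obtain ⟨ρ', U, hρ', hU⟩ := ρ.exists_localizedIn b
  refine mul_left_cancel_of_mem_unitary (Unitary.map_mem i.hom hU) ?_
  change i.hom (Tt.elem U) * ψ (i.hom x) = i.hom (Tt.elem U) * i.hom (ρ.endo x)
  rw [hψ O b hb _ hρ' _ hU (Tt.elem_intertwines U) _ (i.map_mem O x hx), ← map_mul, ← map_mul,
    Tt.elem_intertwines, hρ' O hb.symm x hx]

theorem id (hA : A.RelativeDuality) (hB : B.RelativeDuality) :
    i.IsExtension (StarAlgHom.id ℂ 𝔄) (StarAlgHom.id ℂ 𝔅) := by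
  intro O b hb σ hσ U hU h X hX
  have hmem : U ∈ A.alg b := hA.intertwiner_mem (fun _ _ _ _ => rfl) hσ h
  exact (hB.commute hb hX (i.map_mem b U hmem)).symm

/-- `U ⊗ V` transports `ρ ⊗ σ` to `b`, so it determines `ω` on 𝔅(O); the composite satisfies the
same relation because `ψ` extends `ρ`. -/
theorem eq_comp (hs : 2 ≤ s) {ρ σ : A.Tt} {ψ χ ω : 𝔅 →⋆ₐ[ℂ] 𝔅}
    (hψ : i.IsExtension ρ.endo ψ) (hχ : i.IsExtension σ.endo χ)
    (hω : i.IsExtension (ρ ⊗ σ).endo ω) : ω = ψ.comp χ := by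
  refine B.endo_ext fun O X hX => ?_
  obtain ⟨b, hb⟩ := DoubleCone.exists_spacelikeTo hs O
  obtain ⟨ρ', U, hρ', hU⟩ := ρ.exists_localizedIn b
  obtain ⟨σ', V, hσ', hV⟩ := σ.exists_localizedIn b
  have hUV : Tt.elem (U ⊗ₘ V) ∈ unitary 𝔄 := by
    rw [Tt.elem_tensorHom]
    exact mul_mem hU (Unitary.map_mem ρ.endo hV)
  have h1 := hψ O b hb _ hρ' _ hU (Tt.elem_intertwines U) X hX
  have h2 := hχ O b hb _ hσ' _ hV (Tt.elem_intertwines V) X hX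
  refine mul_left_cancel_of_mem_unitary (Unitary.map_mem i.hom hUV) ?_
  rw [hω O b hb _ (hρ'.comp hσ') _ hUV (Tt.elem_intertwines (U ⊗ₘ V)) X hX, Tt.elem_tensorHom,
    map_mul, StarAlgHom.comp_apply, mul_assoc, ← hψ.apply_hom hs, ← map_mul, h2, map_mul,
    ← mul_assoc, ← mul_assoc, h1]

end IsExtension

variable (i) (hs : 2 ≤ s) (hA : A.RelativeDuality) (hB : B.RelativeDuality)

/-- The canonical extension of a localized transportable endomorphism. -/
def extendEndo (ρ : A.Tt) : 𝔅 →⋆ₐ[ℂ] 𝔅 :=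
  (exists_isExtension (i := i) hs hA hB ρ).choose

theorem isExtension_extendEndo (ρ : A.Tt) : i.IsExtension ρ.endo (i.extendEndo hs hA hB ρ) :=
  (exists_isExtension hs hA hB ρ).choose_spec

/-- The canonical extension of an object of `𝒯_t(𝔄)` to an object of `𝒯_t(𝔅)`. -/
def extendObj (ρ : A.Tt) : B.Tt where
  endo := i.extendEndo hs hA hB ρ
  localized :=
    let ⟨a, ha⟩ := ρ.localized
    ⟨a, (i.isExtension_extendEndo hs hA hB ρ).localizedIn ha⟩
  transportable O :=
    let ⟨σ, U, hσ, hU⟩ := ρ.exists_localizedIn O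
    ⟨i.extendEndo hs hA hB σ, (i.isExtension_extendEndo hs hA hB σ).localizedIn hσ,
      i.hom (Tt.elem U), Unitary.map_mem i.hom hU,
      (i.isExtension_extendEndo hs hA hB ρ).intertwines hs hA hB
        (i.isExtension_extendEndo hs hA hB σ) U⟩

/-- The functor `𝒯_t(𝔄) ⥤ 𝒯_t(𝔅)` given by an inclusion of nets satisfying relative duality. -/
def extension : A.Tt ⥤ B.Tt where
  obj := i.extendObj hs hA hB
  map {ρ σ} T := Tt.ofElem (i.hom (Tt.elem T))
    ((i.isExtension_extendEndo hs hA hB ρ).intertwines hs hA hB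
      (i.isExtension_extendEndo hs hA hB σ) T)
  map_id _ := Tt.hom_ext (map_one i.hom)
  map_comp f g := Tt.hom_ext (map_mul i.hom (Tt.elem g) (Tt.elem f))

theorem isExtension_extension_obj (ρ : A.Tt) :
    i.IsExtension ρ.endo ((i.extension hs hA hB).obj ρ).endo :=
  i.isExtension_extendEndo hs hA hB ρ

@[simp] theorem elem_extension_map {ρ σ : A.Tt} (T : ρ ⟶ σ) :
    Tt.elem ((i.extension hs hA hB).map T) = i.hom (Tt.elem T) := rfl

@[simp] theorem extension_obj_endo_hom (ρ : A.Tt) (x : 𝔄) :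
    ((i.extension hs hA hB).obj ρ).endo (i.hom x) = i.hom (ρ.endo x) :=
  (i.isExtension_extension_obj hs hA hB ρ).apply_hom hs x

theorem extension_obj_tensor (ρ σ : A.Tt) : (i.extension hs hA hB).obj (ρ ⊗ σ)
    = (i.extension hs hA hB).obj ρ ⊗ (i.extension hs hA hB).obj σ :=
  Tt.ext ((i.isExtension_extension_obj hs hA hB ρ).eq_comp hs
    (i.isExtension_extension_obj hs hA hB σ) (i.isExtension_extension_obj hs hA hB (ρ ⊗ σ)))

theorem extension_obj_unit : (i.extension hs hA hB).obj (𝟙_ A.Tt) = 𝟙_ B.Tt :=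
  Tt.ext ((i.isExtension_extension_obj hs hA hB (𝟙_ A.Tt)).unique hs hA hB
    (IsExtension.id hA hB))

theorem extension_obj_injective : Function.Injective (i.extension hs hA hB).obj := by
  intro ρ σ h
  refine Tt.ext (StarAlgHom.ext fun x => i.injective ?_)
  rw [← i.extension_obj_endo_hom hs hA hB, h, i.extension_obj_endo_hom hs hA hB]

/-- The functor carries a spacelike transport `U` to a spacelike transport, so it preserves the
formula `U* ρ(U)`. -/
theorem hom_exchange (ρ σ : A.Tt) : i.hom (Tt.exchange hs hA ρ σ)
    = Tt.exchange hs hB ((i.extension hs hA hB).obj ρ) ((i.extension hs hA hB).obj σ) := by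
  obtain ⟨c, hc⟩ := ρ.localized
  obtain ⟨d, τ, U, hd, hτ, hU⟩ := Tt.exists_spacelike_transport hs σ c
  rw [Tt.exchange_eq_star_mul_map hs hA hd hc hτ U hU,
    Tt.exchange_eq_star_mul_map hs hB hd
      ((i.isExtension_extension_obj hs hA hB ρ).localizedIn hc)
      ((i.isExtension_extension_obj hs hA hB τ).localizedIn hτ)
      ((i.extension hs hA hB).map U) (Unitary.map_mem i.hom hU), elem_extension_map,
    extension_obj_endo_hom, map_mul, map_star]

/-- The identity, as an isomorphism between equal objects. -/
def _root_.Net.Tt.isoOfEq {N : Net s 𝔅} {ρ σ : N.Tt} (h : ρ = σ) : ρ ≅ σ :=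
  Tt.isoOfElem 1 1 (by simp [h]) (by simp [h]) (one_mul 1) (one_mul 1)

@[simp] theorem _root_.Net.Tt.elem_isoOfEq_hom {N : Net s 𝔅} {ρ σ : N.Tt} (h : ρ = σ) :
    Tt.elem (Tt.isoOfEq h).hom = 1 := rfl

/-- The strict monoidal structure of the extension functor. -/
def extensionCoreMonoidal : (i.extension hs hA hB).CoreMonoidal where
  εIso := Tt.isoOfEq (i.extension_obj_unit hs hA hB).symm
  μIso ρ σ := Tt.isoOfEq (i.extension_obj_tensor hs hA hB ρ σ).symm
  μIso_hom_natural_left f σ := Tt.hom_ext (by simp)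
  μIso_hom_natural_right ρ g := Tt.hom_ext (by simp)
  associativity ρ σ τ := Tt.hom_ext (by simp)
  left_unitality ρ := Tt.hom_ext (by simp)
  right_unitality ρ := Tt.hom_ext (by simp)

/-- The extension functor is braided for the canonical permutation symmetries. -/
@[reducible] def extensionBraided :
    letI := Tt.canonicalSymmetry hs hA
    letI := Tt.canonicalSymmetry hs hB
    (i.extension hs hA hB).Braided :=
  letI := Tt.canonicalSymmetry hs hA
  letI := Tt.canonicalSymmetry hs hB
  { toMonoidal := (i.extensionCoreMonoidal hs hA hB).toMonoidal
    braided := fun ρ σ => Tt.hom_ext (by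
      -- The tensor comparison maps have underlying element 1, so the compatibility square reduces
      -- to an identity between exchange operators.
      refine (mul_one _).trans (Eq.trans ?_ (one_mul _).symm)
      exact i.hom_exchange hs hA hB ρ σ) }

end Inclusion

end Net

end

/-! ### Assembly of the theorem. -/

theorem theorem2p2 {s : ℕ} (hs : 2 ≤ s) {𝔄 : Type u} [CStarAlgebra 𝔄] {𝔅 : Type v}
    [CStarAlgebra 𝔅] (A : Net s 𝔄) (B : Net s 𝔅) (i : A.Inclusion B)
    (hA : A.RelativeDuality) (hB : B.RelativeDuality) :
    -- every cocycle of `A` defines a field of objects of `𝒯_t(A)`, `ρ_a` being localized in `a`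
    (∀ (z : A.OneCocycle) (a : DoubleCone s),
      ∃ ρ : A.Tt, A.LocalizedIn ρ.endo a ∧ z.Induces a ρ.endo) ∧
    -- and every object of `𝒯_t(A)` localized in `a` arises in this way
    (∀ (ρ : A.Tt) (a : DoubleCone s), A.LocalizedIn ρ.endo a →
      ∃ z : A.OneCocycle, z.Induces a ρ.endo) ∧
    -- the categories carry their canonical permutation symmetries
    ∃ (εA : SymmetricCategory A.Tt) (εB : SymmetricCategory B.Tt),
      Net.Tt.IsCanonicalSymmetry A εA ∧ Net.Tt.IsCanonicalSymmetry B εB ∧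
      ∃ (F : A.Tt ⥤ B.Tt) (_ : F.Braided),
        -- on objects: the extension of endomorphisms through cocycles
        (∀ (ρ : A.Tt) (x : 𝔄), (F.obj ρ).endo (i.hom x) = i.hom (ρ.endo x)) ∧
        (∀ (ρ : A.Tt) (z : A.OneCocycle) (a : DoubleCone s),
          z.Induces a ρ.endo → (z.map i).Induces a (F.obj ρ).endo) ∧
        (∀ (ρ : A.Tt) (a : DoubleCone s),
          A.LocalizedIn ρ.endo a → B.LocalizedIn (F.obj ρ).endo a) ∧
        -- on arrows: the given inclusion
        (∀ {ρ σ : A.Tt} (T : ρ ⟶ σ), Net.Tt.elem (F.map T) = i.hom (Net.Tt.elem T)) ∧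
        -- an inclusion of categories
        Function.Injective F.obj ∧ F.Faithful ∧
        -- preserving the structure of a C*-category
        F.Additive ∧ F.Linear ℂ ∧
        (∀ {ρ σ : A.Tt} (T : ρ ⟶ σ), F.map (Net.Tt.adjoint T) = Net.Tt.adjoint (F.map T)) ∧
        (∀ {ρ σ : A.Tt} (T : ρ ⟶ σ), ‖F.map T‖ = ‖T‖) ∧
        -- strictly preserving the tensor structure
        (∀ ρ σ : A.Tt, F.obj (ρ ⊗ σ) = F.obj ρ ⊗ F.obj σ) ∧
        F.obj (𝟙_ A.Tt) = 𝟙_ B.Tt ∧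
        (∀ {ρ ρ' σ σ' : A.Tt} (S : ρ ⟶ ρ') (T : σ ⟶ σ'),
          Net.Tt.elem (F.map (S ⊗ₘ T)) = Net.Tt.elem (F.map S ⊗ₘ F.map T)) ∧
        (∀ ρ σ : A.Tt, Net.Tt.elem (Functor.LaxMonoidal.μ F ρ σ) = 1) ∧
        Net.Tt.elem (Functor.LaxMonoidal.ε F) = 1 ∧
        -- and the permutation symmetry
        (∀ ρ σ : A.Tt, i.hom (Net.Tt.elem (εA.braiding ρ σ).hom) =
          Net.Tt.elem (εB.braiding (F.obj ρ) (F.obj σ)).hom) := by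
  refine ⟨fun z a => ?_, fun ρ a ha => ρ.transportable.exists_induces hA ha,
    Net.Tt.canonicalSymmetry hs hA, Net.Tt.canonicalSymmetry hs hB,
    Net.Tt.isCanonicalSymmetry_canonicalSymmetry hs hA,
    Net.Tt.isCanonicalSymmetry_canonicalSymmetry hs hB,
    i.extension hs hA hB, i.extensionBraided hs hA hB,
    i.extension_obj_endo_hom hs hA hB,
    fun ρ z a hz => (i.isExtension_extension_obj hs hA hB ρ).induces hz,
    fun ρ a ha => (i.isExtension_extension_obj hs hA hB ρ).localizedIn ha,
    fun T => rfl, i.extension_obj_injective hs hA hB, ⟨fun {ρ σ} f g h => ?_⟩,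
    ⟨fun {ρ σ f g} => ?_⟩, ⟨fun {ρ σ} f r => ?_⟩, fun T => ?_, fun T => ?_,
    i.extension_obj_tensor hs hA hB, i.extension_obj_unit hs hA hB, fun S T => ?_,
    fun ρ σ => rfl, rfl, i.hom_exchange hs hA hB⟩
  · obtain ⟨ρ, hρ⟩ := z.exists_induces hs hA a
    exact ⟨⟨ρ, ⟨a, hρ.localizedIn⟩, hρ.transportable⟩, hρ.localizedIn, hρ⟩
  · exact Net.Tt.hom_ext (i.injective (congrArg Net.Tt.elem h))
  · exact Net.Tt.hom_ext (map_add i.hom _ _)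
  · exact Net.Tt.hom_ext (map_smul i.hom r (Net.Tt.elem f))
  · exact Net.Tt.hom_ext (map_star i.hom (Net.Tt.elem T))
  · exact NonUnitalStarAlgHom.norm_map i.hom i.injective (Net.Tt.elem T)
  · simp
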